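/- **Setting.** A *metric measure space* $(X,d,m)$ is a complete separable metric space with a Borel measure $m\ge 0$ that is finite on bounded sets. It is *pointed* if a point of $\operatorname{spt}(m)$ is fixed. It is *doubling* if there is $C\ge 1$ with $m(B_{2r}(x))\le C\,m(B_r(x))$ for all $x\in X$ and $r>0$, where $B_r(x)$ denotes the open ball. An *$n$-chart* ($n\in\mathbb N$) is a pair $(U,\varphi)$ where $U\subset X$ is Borel, $m|_U\ll\mathcal H^n$, and $\varphi:U\to\mathbb R^n$ is biLipschitz onto its image. An *atlas* is a countable family of $n_i$-charts $(U_i,\varphi_i)_{i\in\mathbb N}$ whose domains form a partition of $X$ up to $m$-null sets; $(X,d,m)$ is *$m$-rectifiable* if it admits an atlas. Put $n(x)=n_i$ for $x\in U_i$. **The norms $\|\cdot\|_x$.** Fix an atlas and, for each $i$, a Lipschitz extension $F_i:\mathbb R^{n_i}\to\ell^\infty$ of $\iota_i\circ\varphi_i^{-1}:\varphi_i(U_i)\to\ell^\infty$, where $\iota_i:U_i\to\ell^\infty$ is an isometric embedding. For $x\in U_i$ let $$\|v\|_x=\lim_{r\searrow0}\frac{\|F_i(\varphi_i(x)+rv)-F_i(\varphi_i(x))\|_{\ell^\infty}}{r},\qquad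 v\in\mathbb R^{n(x)},$$ whenever the limits exist (the metric differential of $\varphi_i^{-1}$ at $\varphi_i(x)$). If $\|\cdot\|_x$ is a norm, let $\mathcal H_x^{n(x)}$ be the $n(x)$-dimensional Hausdorff measure of $(\mathbb R^{n(x)},\|\cdot\|_x)$ and $\underline{\mathcal H}_x^{n(x)}=\mathcal H_x^{n(x)}/\mathcal H_x^{n(x)}(B_1^{\|\cdot\|_x}(0))$. **Tangent cones.** A pointed metric measure space $(Y,d_Y,m_Y,q)$ belongs to $\mathrm{Tan}_p(X,d,m)$ if there are radii $r_k\searrow0$ such that for every $\varepsilon\in(0,1)$ and a.e. $R>1$ there are $\bar k\in\mathbb N$ and Borel maps $\psi^k:B_{Rr_k}(p)\to Y$, $k\ge\bar k$, with * (i) $\psi^k(p)=q$; * (ii) $|d(x,y)-r_k\,d_Y(\psi^k(x),\psi^k(y))|\le\varepsilon r_k$ for all $x,y\in B_{Rr_k}(p)$; * (iii) $B_{R-\varepsilon}(q)$ is contained in the open $\varepsilon$-neighbourhood of $\psi^k(B_{Rr_k}(p))$; * (iv) $m(B_{r_k}(p))^{-1}\,\psi^k_\#(m|_{B_{Rr_k}(p)})\to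 m_Y|_{B_R(q)}$ as $k\to\infty$, tested against bounded continuous functions $Y\to\mathbb R$ with bounded support. Two pointed metric measure spaces are *isomorphic* if there is an isometric bijection between them that preserves base points and measures. **Proposition.** Let $(X,d,m)$ be a doubling, $m$-rectifiable metric measure space. Then, for every atlas and every choice of the extensions $F_i$ as above, for $m$-a.e. $x\in X$ the limits defining $\|\cdot\|_x$ exist and $\|\cdot\|_x$ is a norm on $\mathbb R^{n(x)}$, the space $$\big(\mathbb R^{n(x)},\|\cdot\|_x,\underline{\mathcal H}_x^{n(x)},0\big)$$ belongs to $\mathrm{Tan}_x(X,d,m)$, and every element of $\mathrm{Tan}_x(X,d,m)$ is isomorphic to it. -/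

import Mathlib

open MeasureTheory Set Filter Topology
open scoped ENNReal NNReal

universe u v w

namespace MetricMeasure

/-! ### Metric measure spaces -/

/-- A measure is boundedly finite if balls (equivalently, bounded sets) have finite measure. -/
def BoundedlyFinite {X : Type u} [MetricSpace X] [MeasurableSpace X] (m : Measure X) : Prop :=
  ∀ (x : X) (r : ℝ), m (Metric.ball x r) < ∞

/-- A measure is doubling if it is `C`-doubling, at all points and all scales, for some finite
constant `C ≥ 1`. -/
def IsDoubling {X : Type u} [MetricSpace X] [MeasurableSpace X] (m : Measure X) : Prop :=
  ∃ C : ℝ≥0, 1 ≤ C ∧ ∀ (x : X) (r : ℝ), 0 < r →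
    m (Metric.ball x (2 * r)) ≤ (C : ℝ≥0∞) * m (Metric.ball x r)

/-- A pointed metric measure space: a complete separable metric space with a boundedly finite
Borel measure and a base point in the support of the measure. -/
structure PointedMMS where
  carrier : Type v
  [metric : MetricSpace carrier]
  [complete : CompleteSpace carrier]
  [separable : TopologicalSpace.SeparableSpace carrier]
  [measurable : MeasurableSpace carrier]
  [borel : BorelSpace carrier]
  measure : Measure carrier
  boundedlyFinite : BoundedlyFinite measure
  point : carrier
  point_mem : point ∈ measure.support

attribute [instance] PointedMMS.metric PointedMMS.complete PointedMMS.separable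
  PointedMMS.measurable PointedMMS.borel

/-- Two pointed metric measure spaces are isomorphic if there is an isometric bijection between
them that preserves base points and measures. -/
def PointedMMS.Iso (Y : PointedMMS.{v}) (Z : PointedMMS.{w}) : Prop :=
  ∃ e : Y.carrier ≃ᵢ Z.carrier, e Y.point = Z.point ∧ Y.measure.map e = Z.measure

/-! ### Tangent cones -/

/-- The pointed measured Gromov-Hausdorff convergence of `(X, d / r k, m / m (B_{r k}(p)), p)` to
`Y`. The approximating maps are only used on the balls `B_{R * r k}(p)`; a Borel map
on such a ball is the restriction of a Borel map on `X` (extend it by a constant). -/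
def BlowUpsConverge {X : Type u} [MetricSpace X] [MeasurableSpace X] (m : Measure X) (p : X)
    (r : ℕ → ℝ) (Y : PointedMMS.{v}) : Prop :=
  ∀ ε ∈ Ioo (0 : ℝ) 1, ∀ᵐ R : ℝ, 1 < R →
    ∃ (k₀ : ℕ) (ψ : ℕ → X → Y.carrier),
      (∀ k ≥ k₀, Measurable (ψ k)) ∧
      (∀ k ≥ k₀, ψ k p = Y.point) ∧
      (∀ k ≥ k₀, ∀ x ∈ Metric.ball p (R * r k), ∀ y ∈ Metric.ball p (R * r k),
        |dist x y - r k * dist (ψ k x) (ψ k y)| ≤ ε * r k) ∧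
      (∀ k ≥ k₀, Metric.ball Y.point (R - ε) ⊆
        Metric.thickening ε (ψ k '' Metric.ball p (R * r k))) ∧
      (∀ f : BoundedContinuousFunction Y.carrier ℝ, Bornology.IsBounded (Function.support f) →
        Tendsto
          (fun k => ∫ y, f y ∂((m (Metric.ball p (r k)))⁻¹ •
            (m.restrict (Metric.ball p (R * r k))).map (ψ k)))
          atTop (𝓝 (∫ y in Metric.ball Y.point R, f y ∂Y.measure)))

/-- The tangent cone of `(X, d, m)` at `p`: all limits, in the pointed measured Gromov-Hausdorff
sense, of the normalised blow-ups of `X` at `p` along some sequence of radii `r k ↘ 0`. -/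
def TangentCone {X : Type u} [MetricSpace X] [MeasurableSpace X] (m : Measure X) (p : X) :
    Set PointedMMS.{v} :=
  {Y | ∃ r : ℕ → ℝ, (∀ k, 0 < r k) ∧ Antitone r ∧ Tendsto r atTop (𝓝 0) ∧
    BlowUpsConverge m p r Y}

/-! ### Rectifiable spaces -/

section Rectifiable

variable {X : Type u} [MetricSpace X] [MeasurableSpace X] [BorelSpace X]

/-- `(U, φ)` is an `n`-chart: `U` is Borel, `m` restricted to `U` is absolutely continuous with
respect to the `n`-dimensional Hausdorff measure, and `φ` is biLipschitz from `U` onto its image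
in `ℝⁿ` (the values of `φ` outside `U` are irrelevant). -/
structure IsChart (m : Measure X) {n : ℕ} (U : Set X) (φ : X → EuclideanSpace ℝ (Fin n)) :
    Prop where
  measurableSet : MeasurableSet U
  absolutelyContinuous : m.restrict U ≪ Measure.hausdorffMeasure (n : ℝ)
  lipschitz : ∃ K : ℝ≥0, LipschitzOnWith K φ U
  antilipschitz : ∃ K : ℝ≥0, AntilipschitzWith K (U.domRestrict φ)

/-- An atlas: countably many charts, of possibly different (and unbounded) dimensions, whose
domains form a partition of the space up to null sets. -/
structure Atlas (m : Measure X) where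
  dim : ℕ → ℕ
  U : ℕ → Set X
  φ : (i : ℕ) → X → EuclideanSpace ℝ (Fin (dim i))
  isChart : ∀ i, IsChart m (U i) (φ i)
  disjoint : Pairwise (Function.onFun (AEDisjoint m) U)
  cover : m (⋃ i, U i)ᶜ = 0

/-- `(X, d, m)` is `m`-rectifiable if it admits an atlas. -/
def IsRectifiable (m : Measure X) : Prop := Nonempty (Atlas m)

end Rectifiable

/-! ### The metric differential -/

/-- The inverse `φ(U) → X` of a map `φ` that is injective on `U`. -/
noncomputable def inverseOn {X : Type u} {E : Type v} (U : Set X) (φ : X → E) : φ '' U → X :=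
  fun a => Classical.choose a.2

theorem inverseOn_apply {X : Type u} {E : Type v} {U : Set X} {φ : X → E} (h : InjOn φ U)
    {x : X} (hx : x ∈ U) : inverseOn U φ ⟨φ x, mem_image_of_mem φ hx⟩ = x := by
  have hs := Classical.choose_spec (mem_image_of_mem φ hx)
  exact h hs.1 hx hs.2

/-- For `f : E → X` with `E ⊆ ℝⁿ`, the map `F : ℝⁿ → ℓ^∞` is a Lipschitz extension of `ι ∘ f`, for
some isometric embedding `ι` of `f(E)` into `ℓ^∞` (the values of `ι` outside `f(E)` are
irrelevant). -/
def IsLinftyExtension {X : Type u} [MetricSpace X] {n : ℕ} {E : Set (EuclideanSpace ℝ (Fin n))}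
    (f : E → X) (F : EuclideanSpace ℝ (Fin n) → lp (fun _ : ℕ => ℝ) ∞) : Prop :=
  ∃ ι : X → lp (fun _ : ℕ => ℝ) ∞,
    (∀ x ∈ range f, ∀ y ∈ range f, dist (ι x) (ι y) = dist x y) ∧
    (∃ K : ℝ≥0, LipschitzWith K F) ∧ ∀ a : E, F a = ι (f a)

/-- A norm on `ℝⁿ`. -/
structure NormOn (n : ℕ) extends Seminorm ℝ (EuclideanSpace ℝ (Fin n)) where
  eq_zero_of_map_eq_zero : ∀ v, toFun v = 0 → v = 0

/-- The norm `N` is the metric differential at `a` of the map with Lipschitz extension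
`F : ℝⁿ → ℓ^∞`: for every `v`, the limit of `‖F (a + r v) - F a‖ / r` as `r ↘ 0` exists and equals
`N v`. -/
def HasMetricDifferential {n : ℕ} (F : EuclideanSpace ℝ (Fin n) → lp (fun _ : ℕ => ℝ) ∞)
    (a : EuclideanSpace ℝ (Fin n)) (N : NormOn n) : Prop :=
  ∀ v, Tendsto (fun r : ℝ => ‖F (a + r • v) - F a‖ / r) (𝓝[>] 0) (𝓝 (N.toSeminorm v))

/-! ### The model spaces `(ℝⁿ, N, normalised Hausdorff measure, 0)` -/

/-- The vector space `ℝⁿ`, to be endowed with the norm `N` (and nothing else). -/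
def NormedRn {n : ℕ} (_N : NormOn n) : Type := EuclideanSpace ℝ (Fin n)

namespace NormedRn

variable {n : ℕ} (N : NormOn n)

noncomputable instance : AddCommGroup (NormedRn N) :=
  inferInstanceAs (AddCommGroup (EuclideanSpace ℝ (Fin n)))

noncomputable instance : Module ℝ (NormedRn N) :=
  inferInstanceAs (Module ℝ (EuclideanSpace ℝ (Fin n)))

noncomputable instance : Norm (NormedRn N) := ⟨fun v => N.toSeminorm v⟩

theorem core : NormedSpace.Core ℝ (NormedRn N) where
  norm_nonneg x := apply_nonneg N.toSeminorm x
  norm_smul c x := map_smul_eq_mul N.toSeminorm c x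
  norm_triangle x y := map_add_le_add N.toSeminorm x y
  norm_eq_zero_iff x :=
    ⟨N.eq_zero_of_map_eq_zero x, fun h => by subst h; exact map_zero N.toSeminorm⟩

noncomputable instance : NormedAddCommGroup (NormedRn N) := NormedAddCommGroup.ofCore (core N)

noncomputable instance : NormedSpace ℝ (NormedRn N) := NormedSpace.ofCore (core N)

noncomputable instance : MeasurableSpace (NormedRn N) := borel _

instance : BorelSpace (NormedRn N) := ⟨rfl⟩

instance : FiniteDimensional ℝ (NormedRn N) :=
  inferInstanceAs (FiniteDimensional ℝ (EuclideanSpace ℝ (Fin n)))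

theorem finrank_eq : Module.finrank ℝ (NormedRn N) = n :=
  finrank_euclideanSpace_fin (𝕜 := ℝ) (n := n)

/-- The `n`-dimensional Hausdorff measure of `(ℝⁿ, N)`, normalised on the unit ball. -/
noncomputable def normalisedHausdorff : Measure (NormedRn N) :=
  (Measure.hausdorffMeasure (n : ℝ) (Metric.ball (0 : NormedRn N) 1))⁻¹ •
    Measure.hausdorffMeasure (n : ℝ)

theorem isAddHaarMeasure : (Measure.hausdorffMeasure (n : ℝ) :
    Measure (NormedRn N)).IsAddHaarMeasure := by
  have h := isAddHaarMeasure_hausdorffMeasure (E := NormedRn N)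
  rwa [finrank_eq N] at h

theorem boundedlyFinite : BoundedlyFinite (normalisedHausdorff N) := by
  have := isAddHaarMeasure N
  have : ProperSpace (NormedRn N) := FiniteDimensional.proper ℝ _
  intro x r
  have h1 : (Measure.hausdorffMeasure (n : ℝ) (Metric.ball (0 : NormedRn N) 1)) ≠ 0 :=
    (Metric.measure_ball_pos _ _ one_pos).ne'
  rw [normalisedHausdorff, Measure.smul_apply, smul_eq_mul]
  exact ENNReal.mul_lt_top (ENNReal.inv_lt_top.2 (pos_iff_ne_zero.2 h1)) measure_ball_lt_top

theorem zero_mem_support : (0 : NormedRn N) ∈ (normalisedHausdorff N).support := by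
  have := isAddHaarMeasure N
  have : ProperSpace (NormedRn N) := FiniteDimensional.proper ℝ _
  rw [Measure.mem_support_iff_forall]
  intro V hV
  have h1 : (Measure.hausdorffMeasure (n : ℝ) (Metric.ball (0 : NormedRn N) 1)) ≠ ∞ :=
    measure_ball_lt_top.ne
  rw [normalisedHausdorff, Measure.smul_apply, smul_eq_mul]
  exact ENNReal.mul_pos (ENNReal.inv_ne_zero.2 h1) (Measure.measure_pos_of_mem_nhds _ hV).ne'

end NormedRn

/-- The pointed metric measure space `(ℝⁿ, N, normalised Hausdorff measure, 0)`. -/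
noncomputable def NormOn.space {n : ℕ} (N : NormOn n) : PointedMMS.{0} :=
  have : CompleteSpace (NormedRn N) := FiniteDimensional.complete ℝ _
  have : ProperSpace (NormedRn N) := FiniteDimensional.proper ℝ _
  { carrier := NormedRn N
    measure := NormedRn.normalisedHausdorff N
    boundedlyFinite := NormedRn.boundedlyFinite N
    point := 0
    point_mem := NormedRn.zero_mem_support N }

end MetricMeasure

/-! At almost every point `x` of a chart domain `U` three things hold at once. Metric: the extension
`F` satisfies a two-point form of Kirchheim's theorem, `‖F (a + r u) - F (a + r v)‖ / r → S (u - v)`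
at `a = φ x`, with `S` the supremum of the differentials of the coordinates of `F`
(`ae_tendsto_coordSeminorm`). Density: `U` has density one at `x` and `φ(U)` has density one at `a`,
so both are asymptotically dense in small balls; as `φ` is Lipschitz this makes `S` a norm
(`norm_le_mul_metricDifferential`). Measure: the image of `m|_U` under `φ` has a density with
respect to Lebesgue measure, because `φ⁻¹` is Lipschitz and `m|_U ≪ ℋⁿ`, and `a` is a Lebesgue point
where this density is positive.

Hence the maps `y ↦ (φ y - φ x) / s` on `U` are almost isometries from the blow-ups to `(ℝⁿ, S)`,
and they carry the normalised measures to normalised Lebesgue measure, which is the normalised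
Hausdorff measure since Haar measures are proportional. `IsBlowUpModel` records this, with a
continuous scale `s` and only on `U`. Points off `U` are sent to the images of almost nearest points
of `U`; doubling makes the remaining mass negligible. So the model is a limit along every sequence
of radii (`IsBlowUpModel.blowUpsConverge`).

For uniqueness, a tangent `Y` and the model are both approximated by the same blow-ups along the
same radii. Ultrafilter limits of corresponding points give an isometry from `Y` to the model
(`exists_isometryEquiv_of_correspondences`). It matches the integrals of one prescribed test
function, and may depend on that function; since every isometry of the model preserves Hausdorff
measure, the dependence is harmless (`IsBlowUpModel.iso`). -/

namespace MetricMeasure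

/-! ### Kirchheim's theorem for Lipschitz maps to `ℓ^∞` -/

section MetricDifferential

variable {E : Type*} [NormedAddCommGroup E]

/-- The coordinates of a Lipschitz map to `ℓ^∞` are Lipschitz. -/
theorem lipschitzWith_coord {F : E → lp (fun _ : ℕ => ℝ) ∞} {L : ℝ≥0} (hF : LipschitzWith L F)
    (j : ℕ) : LipschitzWith L (fun b => F b j) := by
  refine LipschitzWith.of_dist_le_mul fun b c => le_trans ?_ (hF.dist_le_mul b c)
  rw [dist_eq_norm, dist_eq_norm]
  exact lp.norm_apply_le_norm ENNReal.top_ne_zero (F b - F c) j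

variable [NormedSpace ℝ E]

theorem abs_fderiv_coord_le {F : E → lp (fun _ : ℕ => ℝ) ∞} {L : ℝ≥0} (hF : LipschitzWith L F)
    (a v : E) (j : ℕ) : |fderiv ℝ (fun b => F b j) a v| ≤ L * ‖v‖ := by
  rw [← Real.norm_eq_abs]
  exact (ContinuousLinearMap.le_opNorm _ _).trans
    (mul_le_mul_of_nonneg_right (norm_fderiv_le_of_lipschitz ℝ (lipschitzWith_coord hF j))
      (norm_nonneg _))

theorem bddAbove_fderiv_coord {F : E → lp (fun _ : ℕ => ℝ) ∞} {L : ℝ≥0} (hF : LipschitzWith L F)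
    (a v : E) : BddAbove (range fun j => |fderiv ℝ (fun b => F b j) a v|) :=
  ⟨L * ‖v‖, by rintro _ ⟨j, rfl⟩; exact abs_fderiv_coord_le hF a v j⟩

/-- The supremum of the absolute values of the differentials of the coordinates of a Lipschitz map
to `ℓ^∞`. -/
noncomputable def coordSeminorm {F : E → lp (fun _ : ℕ => ℝ) ∞} {L : ℝ≥0} (hF : LipschitzWith L F)
    (a : E) : Seminorm ℝ E :=
  Seminorm.of (fun v => ⨆ j, |fderiv ℝ (fun b => F b j) a v|)
    (fun x y => ciSup_le fun j => by
      rw [map_add]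
      exact (abs_add_le _ _).trans (add_le_add (le_ciSup (bddAbove_fderiv_coord hF a x) j)
        (le_ciSup (bddAbove_fderiv_coord hF a y) j)))
    (fun c x => by
      simp only [map_smul, smul_eq_mul, abs_mul, Real.norm_eq_abs]
      exact (Real.mul_iSup_of_nonneg (abs_nonneg c) _).symm)

theorem coordSeminorm_apply {F : E → lp (fun _ : ℕ => ℝ) ∞} {L : ℝ≥0} (hF : LipschitzWith L F)
    (a v : E) : coordSeminorm hF a v = ⨆ j, |fderiv ℝ (fun b => F b j) a v| := rfl

theorem abs_fderiv_le_coordSeminorm {F : E → lp (fun _ : ℕ => ℝ) ∞} {L : ℝ≥0}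
    (hF : LipschitzWith L F) (a v : E) (j : ℕ) :
    |fderiv ℝ (fun b => F b j) a v| ≤ coordSeminorm hF a v :=
  le_ciSup (bddAbove_fderiv_coord hF a v) j

theorem coordSeminorm_le {F : E → lp (fun _ : ℕ => ℝ) ∞} {L : ℝ≥0}
    (hF : LipschitzWith L F) (a v : E) : coordSeminorm hF a v ≤ L * ‖v‖ :=
  ciSup_le fun j => abs_fderiv_coord_le hF a v j

/-- Two-point metric differentiability holds uniformly on bounded sets. -/
theorem eventually_abs_norm_sub_le [FiniteDimensional ℝ E] {F : E → lp (fun _ : ℕ => ℝ) ∞} {L : ℝ≥0}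
    (hF : LipschitzWith L F) {S : Seminorm ℝ E} {a : E}
    (hS : ∀ u v : E, Tendsto (fun r : ℝ => ‖F (a + r • u) - F (a + r • v)‖ / r) (𝓝[>] 0)
      (𝓝 (S (u - v)))) (M : ℝ) {δ : ℝ} (hδ : 0 < δ) :
    ∀ᶠ r in 𝓝[>] (0 : ℝ), ∀ u v : E, ‖u‖ ≤ M → ‖v‖ ≤ M →
      |‖F (a + r • u) - F (a + r • v)‖ - r * S (u - v)| ≤ δ * r := by
  have : ProperSpace E := FiniteDimensional.proper ℝ E
  have hlip : ∀ r > (0 : ℝ), ∀ u v, ‖F (a + r • u) - F (a + r • v)‖ ≤ r * (L * ‖u - v‖) := by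
    intro r hr u v
    rw [← dist_eq_norm]
    refine (hF.dist_le_mul _ _).trans (le_of_eq ?_)
    rw [dist_add_left, dist_eq_norm, ← smul_sub, norm_smul, Real.norm_of_nonneg hr.le]
    ring
  have hSle : ∀ v, S v ≤ L * ‖v‖ := by
    intro v
    have h1 := hS v 0
    rw [sub_zero] at h1
    refine le_of_tendsto h1 ?_
    filter_upwards [self_mem_nhdsWithin] with r (hr : 0 < r)
    rw [div_le_iff₀ hr]
    have := hlip r hr v 0
    rw [sub_zero] at this
    linarith
  -- The rescaled distances are `L`-Lipschitz in `u` and `v` uniformly in `r`, so pointwise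
  -- convergence on a finite `η`-net suffices. Moving `u` and `v` to the net costs `δ / 4` for `F`
  -- and `δ / 4` for `S`; the net itself costs `δ / 4`.
  obtain ⟨η, hη, hηδ⟩ : ∃ η : ℝ, 0 < η ∧ L * η ≤ δ / 8 := by
    refine ⟨δ / (8 * (L + 1)), by positivity, ?_⟩
    have : (0 : ℝ) ≤ L := L.2
    rw [mul_div_assoc', div_le_div_iff₀ (by positivity) (by positivity)]
    nlinarith
  obtain ⟨T, hTfin, hT⟩ := Metric.totallyBounded_iff.1
    (isCompact_closedBall (0 : E) M).totallyBounded η hη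
  have hev : ∀ᶠ r in 𝓝[>] (0 : ℝ), ∀ u ∈ T, ∀ v ∈ T,
      |‖F (a + r • u) - F (a + r • v)‖ / r - S (u - v)| < δ / 4 := by
    refine (eventually_all_finite hTfin).2 fun u _ => (eventually_all_finite hTfin).2 fun v _ => ?_
    simpa [Real.dist_eq] using Metric.tendsto_nhds.1 (hS u v) (δ / 4) (by positivity)
  filter_upwards [hev, self_mem_nhdsWithin] with r hr (hr0 : 0 < r) u v hu hv
  obtain ⟨u', hu', huu⟩ := mem_iUnion₂.1 (hT (mem_closedBall_zero_iff.2 hu))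
  obtain ⟨v', hv', hvv⟩ := mem_iUnion₂.1 (hT (mem_closedBall_zero_iff.2 hv))
  rw [Metric.mem_ball, dist_eq_norm] at huu hvv
  have h1 := hr u' hu' v' hv'
  have hu1 : (L : ℝ) * ‖u - u'‖ ≤ δ / 8 :=
    (mul_le_mul_of_nonneg_left huu.le L.2).trans hηδ
  have hv1 : (L : ℝ) * ‖v - v'‖ ≤ δ / 8 :=
    (mul_le_mul_of_nonneg_left hvv.le L.2).trans hηδ
  have h2 : |‖F (a + r • u) - F (a + r • v)‖ - ‖F (a + r • u') - F (a + r • v')‖|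
      ≤ r * (δ / 4) := by
    refine (abs_norm_sub_norm_le _ _).trans ?_
    have e : F (a + r • u) - F (a + r • v) - (F (a + r • u') - F (a + r • v')) =
      (F (a + r • u) - F (a + r • u')) - (F (a + r • v) - F (a + r • v')) := by abel
    rw [e]
    refine (norm_sub_le _ _).trans ?_
    have e1 := hlip r hr0 u u'
    have e2 := hlip r hr0 v v'
    nlinarith
  have h3 : |S (u - v) - S (u' - v')| ≤ δ / 4 := by
    have e : u - v - (u' - v') = (u - u') - (v - v') := by abel
    have e1 : |S (u - v) - S (u' - v')| ≤ S (u - v - (u' - v')) := abs_sub_map_le_sub S _ _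
    rw [e] at e1
    have e2 := map_sub_le_add S (u - u') (v - v')
    have e3 := hSle (u - u')
    have e4 := hSle (v - v')
    linarith
  have h4 : |‖F (a + r • u') - F (a + r • v')‖ - r * S (u' - v')| ≤ r * (δ / 4) := by
    have e : ‖F (a + r • u') - F (a + r • v')‖ - r * S (u' - v') =
      r * (‖F (a + r • u') - F (a + r • v')‖ / r - S (u' - v')) := by field_simp
    rw [e, abs_mul, abs_of_pos hr0]
    exact mul_le_mul_of_nonneg_left h1.le hr0.le
  rw [abs_le] at h2 h3 h4 ⊢
  constructor <;> nlinarith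

variable [MeasurableSpace E] [BorelSpace E]

/-- Needed to apply Lebesgue differentiation to the seminorm as a function of the base point. -/
theorem measurable_coordSeminorm {F : E → lp (fun _ : ℕ => ℝ) ∞} {L : ℝ≥0}
    (hF : LipschitzWith L F) (v : E) : Measurable fun a => coordSeminorm hF a v := by
  simp only [coordSeminorm_apply]
  exact Measurable.iSup fun j => (measurable_fderiv_apply_const ℝ (fun b => F b j) v).norm

variable [FiniteDimensional ℝ E]

/-- If the directional derivative of `f` has small averages over the translates of a ball along a
segment, then the increment of `f` over the segment is small up to the radius of the ball. -/
theorem abs_sub_le_of_average_le (μ : Measure E) [μ.IsAddHaarMeasure] {f : E → ℝ} {L : ℝ≥0}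
    (hf : LipschitzWith L f) {g : E → ℝ} {c w : E} {ρ A : ℝ} (hρ : 0 < ρ)
    (hg : LocallyIntegrable g μ) (hfg : ∀ y, |fderiv ℝ f y w| ≤ g y)
    (hA : ∀ s ∈ Icc (0 : ℝ) 1, ⨍ y in Metric.closedBall (c + s • w) ρ, g y ∂μ ≤ A) :
    |f (c + w) - f c| ≤ A + 2 * L * ρ := by
  have : ProperSpace E := FiniteDimensional.proper ℝ E
  set B := Metric.closedBall c ρ with hB
  have hBfin : μ B ≠ ∞ := (isCompact_closedBall c ρ).measure_ne_top
  have hBpos : 0 < μ.real B :=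
    ENNReal.toReal_pos (Metric.measure_closedBall_pos μ c hρ).ne' hBfin
  have : IsFiniteMeasure (μ.restrict B) := ⟨by simpa using hBfin.lt_top⟩
  have hcont : ∀ s : ℝ, Continuous fun y => f (y + s • w) := fun s =>
    hf.continuous.comp (by fun_prop)
  have hint : ∀ s : ℝ, IntegrableOn (fun y => f (y + s • w)) B μ := fun s =>
    (hcont s).continuousOn.integrableOn_compact (isCompact_closedBall c ρ)
  -- Averaging over `B` repairs the possible failure of differentiability along the segment itself:
  -- for each fixed `s`, Rademacher's theorem applies at `y + s • w` for almost every `y`.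
  have hderiv : ∀ s : ℝ, HasDerivAt (fun s : ℝ => ∫ y in B, f (y + s • w) ∂μ)
      (∫ y in B, fderiv ℝ f (y + s • w) w ∂μ) s := by
    intro s
    refine (hasDerivAt_integral_of_dominated_loc_of_lip (s := univ)
      (bound := fun _ => L * ‖w‖) univ_mem
      (.of_forall fun t => (hcont t).aestronglyMeasurable) (hint s) ?_ ?_
      (integrable_const _) ?_).2
    · exact ((measurable_fderiv_apply_const ℝ f w).comp
        (measurable_id.add_const (s • w))).aestronglyMeasurable
    · refine .of_forall fun y => LipschitzOnWith.of_dist_le_mul fun t _ t' _ => ?_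
      refine (hf.dist_le_mul _ _).trans (le_of_eq ?_)
      rw [dist_add_left, dist_eq_norm, ← sub_smul, norm_smul, ← dist_eq_norm, Real.coe_nnabs,
        abs_of_nonneg (by positivity)]
      ring
    · have h1 : ∀ᵐ y ∂μ, DifferentiableAt ℝ f (y + s • w) :=
        (measurePreserving_add_right μ (s • w)).quasiMeasurePreserving.ae hf.ae_differentiableAt
      filter_upwards [ae_restrict_of_ae h1] with y hy
      have h2 : HasDerivAt (fun t : ℝ => y + t • w) w s := by
        simpa using ((hasDerivAt_id s).smul_const w).const_add y
      exact hy.hasFDerivAt.comp_hasDerivAt s h2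
  have hbound : ∀ s ∈ Icc (0 : ℝ) 1, ‖∫ y in B, fderiv ℝ f (y + s • w) w ∂μ‖ ≤ A * μ.real B := by
    intro s hs
    have himg : (fun y => y + s • w) ⁻¹' Metric.closedBall (c + s • w) ρ = B := by
      ext y; simp [hB]
    have hmp := (measurePreserving_add_right μ (s • w)).restrict_preimage
      (Metric.isClosed_closedBall (x := c + s • w) (ε := ρ)).measurableSet
    rw [himg] at hmp
    have hgi : IntegrableOn g (Metric.closedBall (c + s • w) ρ) μ :=
      hg.integrableOn_isCompact (isCompact_closedBall _ _)
    have hemb : MeasurableEmbedding fun y : E => y + s • w :=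
      (Homeomorph.addRight (s • w)).measurableEmbedding
    have h1 : ∫ y in B, g (y + s • w) ∂μ = ∫ y in Metric.closedBall (c + s • w) ρ, g y ∂μ :=
      hmp.integral_comp hemb g
    have h2 : Integrable (fun y => g (y + s • w)) (μ.restrict B) :=
      (hmp.integrable_comp_emb hemb).2 hgi
    have hvol : μ.real (Metric.closedBall (c + s • w) ρ) = μ.real B := by
      rw [hB, Measure.real, Measure.real, Measure.addHaar_closedBall_center,
        Measure.addHaar_closedBall_center μ c]
    calc ‖∫ y in B, fderiv ℝ f (y + s • w) w ∂μ‖ ≤ ∫ y in B, g (y + s • w) ∂μ :=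
          norm_integral_le_of_norm_le h2 (.of_forall fun y => hfg _)
      _ = (⨍ y in Metric.closedBall (c + s • w) ρ, g y ∂μ) * μ.real B := by
          rw [h1, setAverage_eq, hvol, smul_eq_mul]; field_simp
      _ ≤ A * μ.real B := mul_le_mul_of_nonneg_right (hA s hs) hBpos.le
  have hmv : ‖(∫ y in B, f (y + (1 : ℝ) • w) ∂μ) - ∫ y in B, f (y + (0 : ℝ) • w) ∂μ‖
      ≤ A * μ.real B :=
    norm_image_sub_le_of_norm_deriv_le_segment_01' (fun s _ => (hderiv s).hasDerivWithinAt)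
      fun s hs => hbound s (Ico_subset_Icc_self hs)
  have hsub : (∫ y in B, f (y + (1 : ℝ) • w) ∂μ) - ∫ y in B, f (y + (0 : ℝ) • w) ∂μ =
      ∫ y in B, (f (y + w) - f y) ∂μ := by
    rw [← integral_sub (hint 1) (hint 0)]; simp
  rw [hsub] at hmv
  have hint' : IntegrableOn (fun y => f (y + w) - f y) B μ := by
    have := (hint 1).sub (hint 0)
    simp only [one_smul, zero_smul, add_zero] at this
    exact this
  -- Replacing the averaged increment by that at the centre costs `L * ρ` at each endpoint.
  have hosc : ‖∫ y in B, ((f (c + w) - f c) - (f (y + w) - f y)) ∂μ‖ ≤ 2 * L * ρ * μ.real B := by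
    refine norm_setIntegral_le_of_norm_le_const hBfin.lt_top fun y hy => ?_
    have e1 := hf.dist_le_mul (c + w) (y + w)
    have e2 := hf.dist_le_mul y c
    have e3 : dist y c ≤ ρ := hy
    rw [dist_add_right, dist_comm c y] at e1
    rw [Real.dist_eq] at e1 e2
    have e4 := mul_le_mul_of_nonneg_left e3 L.2
    have e5 : (f (c + w) - f c) - (f (y + w) - f y) = (f (c + w) - f (y + w)) + (f y - f c) := by
      ring
    rw [Real.norm_eq_abs, e5]
    refine (abs_add_le _ _).trans ?_
    change (L : ℝ) * dist y c ≤ L * ρ at e4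
    linarith
  rw [integral_sub (integrable_const _) hint', setIntegral_const, smul_eq_mul] at hosc
  have hfin : |f (c + w) - f c| * μ.real B ≤ (A + 2 * L * ρ) * μ.real B := by
    have h3 : |f (c + w) - f c| * μ.real B = ‖μ.real B * (f (c + w) - f c)‖ := by
      rw [norm_mul, Real.norm_eq_abs, Real.norm_eq_abs, abs_of_pos hBpos, mul_comm]
    rw [h3]
    calc ‖μ.real B * (f (c + w) - f c)‖
        ≤ ‖μ.real B * (f (c + w) - f c) - ∫ y in B, (f (y + w) - f y) ∂μ‖
          + ‖∫ y in B, (f (y + w) - f y) ∂μ‖ := by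
            simpa using norm_add_le (μ.real B * (f (c + w) - f c) -
              ∫ y in B, (f (y + w) - f y) ∂μ) (∫ y in B, (f (y + w) - f y) ∂μ)
      _ ≤ (A + 2 * L * ρ) * μ.real B := by linarith
  exact le_of_mul_le_mul_right hfin hBpos

/-- The two-point metric differentiability at `a` of a Lipschitz map to `ℓ^∞`, off a null set. -/
theorem ae_tendsto_coordSeminorm (μ : Measure E) [μ.IsAddHaarMeasure]
    {F : E → lp (fun _ : ℕ => ℝ) ∞} {L : ℝ≥0} (hF : LipschitzWith L F) :
    ∀ᵐ a ∂μ, ∀ u v : E, Tendsto (fun r : ℝ => ‖F (a + r • u) - F (a + r • v)‖ / r) (𝓝[>] 0)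
      (𝓝 (coordSeminorm hF a (u - v))) := by
  have : ProperSpace E := FiniteDimensional.proper ℝ E
  obtain ⟨D, hDc, hDd⟩ := TopologicalSpace.exists_countable_dense E
  have hloc : ∀ w, LocallyIntegrable (fun a => coordSeminorm hF a w) μ := fun w =>
    (locallyIntegrable_const (L * ‖w‖)).mono (measurable_coordSeminorm hF w).aestronglyMeasurable
      (.of_forall fun a => by
        rw [Real.norm_of_nonneg (apply_nonneg _ _), Real.norm_of_nonneg (by positivity)]
        exact coordSeminorm_le hF a w)
  have hdiff : ∀ᵐ a ∂μ, ∀ j, DifferentiableAt ℝ (fun b => F b j) a :=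
    ae_all_iff.2 fun j => (lipschitzWith_coord hF j).ae_differentiableAt
  -- Lebesgue points for balls that need not be centred at `a`, only contain it after enlargement by
  -- a factor `k`. Countability of `D` keeps the exceptional set null.
  have hleb := (ae_ball_iff hDc).2 fun w (_ : w ∈ D) => ae_all_iff.2 fun k : ℕ =>
    IsUnifLocDoublingMeasure.ae_tendsto_average.{_, _, 0} μ (hloc w) (k : ℝ)
  filter_upwards [hdiff, hleb] with a hdiff hleb u v
  -- The upper bound must be uniform in the coordinate `j`, which differentiability of each
  -- coordinate does not give. The seminorm dominates all the differentials, so its averages over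
  -- balls of radius `δ * r` along the segment control all increments at once.
  have hup : ∀ w ∈ D, ∀ η > 0, ∀ᶠ r in 𝓝[>] (0 : ℝ),
      ‖F (a + r • (v + w)) - F (a + r • v)‖ ≤ r * (coordSeminorm hF a w + η) := by
    intro w hw η hη
    obtain ⟨δ, hδ, hδη⟩ : ∃ δ : ℝ, 0 < δ ∧ 2 * L * δ ≤ η / 2 := by
      refine ⟨η / (4 * (L + 1)), by positivity, ?_⟩
      have : (0 : ℝ) ≤ L := L.2
      rw [mul_div_assoc', div_le_div_iff₀ (by positivity) (by positivity)]
      nlinarith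
    obtain ⟨k, hk⟩ := exists_nat_ge ((‖v‖ + ‖w‖) / δ)
    rw [div_le_iff₀ hδ] at hk
    -- The principal factor makes the convergence uniform in the position `s` of the centre on the
    -- segment; all centres lie within `r * (‖v‖ + ‖w‖) ≤ k * (δ * r)` of `a`.
    have htend := hleb w hw k (l := 𝓝[>] (0 : ℝ) ×ˢ 𝓟 (Icc (0 : ℝ) 1))
      (fun q : ℝ × ℝ => a + q.1 • v + q.2 • q.1 • w) (fun q => δ * q.1) ?_ ?_
    · have hev := htend.eventually_lt_const
        (show coordSeminorm hF a w < coordSeminorm hF a w + η / 2 by linarith)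
      rw [eventually_prod_principal_iff] at hev
      filter_upwards [hev, self_mem_nhdsWithin] with r hr (hr0 : 0 < r)
      refine lp.norm_le_of_forall_le (mul_nonneg hr0.le (add_nonneg (apply_nonneg _ _) hη.le))
        fun j => ?_
      have hmain := abs_sub_le_of_average_le μ (lipschitzWith_coord hF j)
        (g := fun y => r * coordSeminorm hF y w) (c := a + r • v) (w := r • w) (ρ := δ * r)
        (A := r * (coordSeminorm hF a w + η / 2)) (by positivity)
        ((hloc w).smul r) ?_ ?_
      · rw [add_assoc, ← smul_add] at hmain
        calc ‖(F (a + r • (v + w)) - F (a + r • v)) j‖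
            = |F (a + r • (v + w)) j - F (a + r • v) j| := rfl
          _ ≤ _ := hmain
          _ ≤ _ := by nlinarith
      · intro y
        rw [map_smul, smul_eq_mul, abs_mul, abs_of_pos hr0]
        exact mul_le_mul_of_nonneg_left (abs_fderiv_le_coordSeminorm hF y w j) hr0.le
      · intro s hs
        rw [setAverage_eq, integral_const_mul, smul_eq_mul, mul_left_comm]
        have := hr s hs
        rw [setAverage_eq, smul_eq_mul] at this
        exact mul_le_mul_of_nonneg_left this.le hr0.le
    · refine Tendsto.comp (y := 𝓝[>] (0 : ℝ)) (g := fun r => δ * r) ?_ tendsto_fst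
      refine tendsto_nhdsWithin_iff.2 ⟨?_, ?_⟩
      · have : Tendsto (fun r : ℝ => δ * r) (𝓝 0) (𝓝 (δ * 0)) := tendsto_id.const_mul δ
        rw [mul_zero] at this
        exact this.mono_left nhdsWithin_le_nhds
      · filter_upwards [self_mem_nhdsWithin] with r (hr : 0 < r)
        exact mul_pos hδ hr
    · rw [eventually_prod_principal_iff]
      filter_upwards [self_mem_nhdsWithin] with r (hr0 : 0 < r) s hs
      rw [Metric.mem_closedBall, dist_comm, dist_eq_norm]
      have h1 : a + r • v + s • r • w - a = r • (v + s • w) := by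
        rw [smul_add, smul_comm s r w]; abel
      rw [h1, norm_smul, Real.norm_of_nonneg hr0.le]
      have h2 : ‖v + s • w‖ ≤ ‖v‖ + ‖w‖ := by
        refine (norm_add_le _ _).trans (add_le_add le_rfl ?_)
        rw [norm_smul, Real.norm_of_nonneg hs.1]
        exact mul_le_of_le_one_left (norm_nonneg _) hs.2
      nlinarith
  rw [Metric.tendsto_nhds]
  intro η hη
  -- For the lower bound one coordinate nearly attaining the supremum is enough.
  have hlow : ∀ᶠ r in 𝓝[>] (0 : ℝ),
      coordSeminorm hF a (u - v) - η < ‖F (a + r • u) - F (a + r • v)‖ / r := by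
    obtain ⟨j, hj⟩ : ∃ j, coordSeminorm hF a (u - v) - η <
        |fderiv ℝ (fun b => F b j) a (u - v)| :=
      exists_lt_of_lt_ciSup (by rw [← coordSeminorm_apply hF]; linarith)
    have hd : ∀ w : E, Tendsto (fun r : ℝ => (F (a + r • w) j - F a j) / r) (𝓝[>] 0)
        (𝓝 (fderiv ℝ (fun b => F b j) a w)) := by
      intro w
      have h2 : HasDerivAt (fun t : ℝ => a + t • w) w 0 := by
        simpa using ((hasDerivAt_id (0 : ℝ)).smul_const w).const_add a
      have h4 : HasFDerivAt (fun b => F b j) (fderiv ℝ (fun b => F b j) a) (a + (0 : ℝ) • w) := by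
        simpa using (hdiff j).hasFDerivAt
      have h3 := (h4.comp_hasDerivAt 0 h2).tendsto_slope_zero_right
      refine h3.congr fun r => ?_
      simp [div_eq_inv_mul]
    have hd2 := ((hd u).sub (hd v)).abs
    rw [← map_sub] at hd2
    filter_upwards [hd2.eventually_const_lt hj, self_mem_nhdsWithin] with r hr (hr0 : 0 < r)
    refine hr.trans_le ?_
    rw [← sub_div, abs_div, abs_of_pos hr0, sub_sub_sub_cancel_right]
    exact div_le_div_of_nonneg_right
      (lp.norm_apply_le_norm ENNReal.top_ne_zero (F (a + r • u) - F (a + r • v)) j) hr0.le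
  obtain ⟨w, hw, hwd⟩ : ∃ w ∈ D, (L + 1 : ℝ) * ‖u - v - w‖ < η / 4 := by
    obtain ⟨w, hw, hwd⟩ := hDd.exists_dist_lt (u - v) (ε := η / (4 * (L + 1))) (by positivity)
    refine ⟨w, hw, ?_⟩
    rw [dist_eq_norm, lt_div_iff₀ (by positivity)] at hwd
    linarith
  have hw1 : (L : ℝ) * ‖u - v - w‖ < η / 4 := by nlinarith [norm_nonneg (u - v - w)]
  filter_upwards [hlow, hup w hw (η / 4) (by positivity), self_mem_nhdsWithin] with r h1 h2
    (hr0 : 0 < r)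
  rw [Real.dist_eq, abs_lt]
  refine ⟨by linarith, ?_⟩
  have h3 : ‖F (a + r • u) - F (a + r • (v + w))‖ ≤ r * (η / 4) := by
    rw [← dist_eq_norm]
    refine (hF.dist_le_mul _ _).trans ?_
    rw [dist_add_left, dist_eq_norm, ← smul_sub, norm_smul, Real.norm_of_nonneg hr0.le,
      ← sub_sub]
    nlinarith
  have h4 : coordSeminorm hF a w ≤ coordSeminorm hF a (u - v) + η / 4 := by
    have h5 : coordSeminorm hF a w ≤ coordSeminorm hF a (u - v) +
        coordSeminorm hF a (w - (u - v)) := by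
      simpa using map_add_le_add (coordSeminorm hF a) (u - v) (w - (u - v))
    have h6 := coordSeminorm_le hF a (w - (u - v))
    rw [norm_sub_rev] at h6
    linarith
  have h7 := norm_sub_le_norm_sub_add_norm_sub (F (a + r • u)) (F (a + r • (v + w)))
    (F (a + r • v))
  have h8 : ‖F (a + r • u) - F (a + r • v)‖ / r < coordSeminorm hF a (u - v) + η := by
    rw [div_lt_iff₀ hr0]
    nlinarith
  linarith

end MetricDifferential

/-! ### Limits of correspondences with vanishing distortion -/

section GromovHausdorff

/-- In a proper space, a function that is bounded along an ultrafilter converges along it. -/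
theorem exists_tendsto_of_dist_le {ι Z : Type*} [MetricSpace Z] [ProperSpace Z] {𝒰 : Ultrafilter ι}
    {z₀ : Z} {z : ι → Z} {M : ℝ} (hz : ∀ᶠ j in (𝒰 : Filter ι), dist (z j) z₀ ≤ M) :
    ∃ w, Tendsto z 𝒰 (𝓝 w) := by
  obtain ⟨w, -, hw⟩ := (isCompact_closedBall z₀ M).ultrafilter_le_nhds (𝒰.map z)
    (le_principal_iff.2 hz)
  exact ⟨w, hw⟩

/-- The points of a sequence of correspondences with vanishing distortion between a complete space
and a proper space are eventually close to the graph of an isometry, along an ultrafilter. -/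
theorem exists_isometryEquiv_of_correspondences {X Y V : Type*} [MetricSpace Y] [CompleteSpace Y]
    [MetricSpace V] [ProperSpace V] {P : ℕ → Set X} {α : ℕ → X → Y} {β : ℕ → X → V} {η : ℕ → ℝ}
    {p : X} {q₀ : Y} {v₀ : V} (hη : Tendsto η atTop (𝓝 0))
    (hdist : ∀ j, ∀ y ∈ P j, ∀ z ∈ P j,
      |dist (α j y) (α j z) - dist (β j y) (β j z)| ≤ η j)
    (hp : ∀ j, p ∈ P j) (hα : ∀ j, α j p = q₀) (hβ : ∀ j, β j p = v₀)
    (hY : ∀ q, ∃ y : ℕ → X, (∀ᶠ j in atTop, y j ∈ P j) ∧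
      Tendsto (fun j => α j (y j)) atTop (𝓝 q))
    (hV : ∀ v, ∃ y : ℕ → X, (∀ᶠ j in atTop, y j ∈ P j) ∧
      Tendsto (fun j => β j (y j)) atTop (𝓝 v)) :
    ∃ e : Y ≃ᵢ V, e q₀ = v₀ ∧ ∀ M : ℝ, ∀ ε > 0, ∀ᶠ j in (hyperfilter ℕ : Filter ℕ),
      ∀ y ∈ P j, dist (α j y) q₀ ≤ M → dist (e (α j y)) (β j y) < ε := by
  -- A nonprincipal ultrafilter replaces the diagonal extraction of subsequences: bounded sequences
  -- in proper spaces converge along it.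
  set 𝒰 := hyperfilter ℕ with h𝒰
  have hle : (𝒰 : Filter ℕ) ≤ atTop := Nat.hyperfilter_le_atTop
  have hη' : Tendsto η 𝒰 (𝓝 0) := hη.mono_left hle
  have hdiff : ∀ y z : ℕ → X, (∀ᶠ j in (𝒰 : Filter ℕ), y j ∈ P j) →
      (∀ᶠ j in (𝒰 : Filter ℕ), z j ∈ P j) →
      Tendsto (fun j => dist (α j (y j)) (α j (z j)) - dist (β j (y j)) (β j (z j))) 𝒰 (𝓝 0) := by
    intro y z hy hz
    refine squeeze_zero_norm' ?_ hη'
    filter_upwards [hy, hz] with j h1 h2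
    exact hdist j _ h1 _ h2
  choose y hyP hyα using hY
  have hyP' : ∀ q, ∀ᶠ j in (𝒰 : Filter ℕ), y q j ∈ P j := fun q => hle (hyP q)
  have hyα' : ∀ q, Tendsto (fun j => α j (y q j)) 𝒰 (𝓝 q) := fun q => (hyα q).mono_left hle
  have hS : ∀ q, ∃ w, Tendsto (fun j => β j (y q j)) 𝒰 (𝓝 w) := by
    intro q
    refine exists_tendsto_of_dist_le (z₀ := v₀) (M := dist q q₀ + 1 + 1) ?_
    have h1 := (tendsto_iff_dist_tendsto_zero.1 (hyα' q)).eventually_lt_const one_pos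
    filter_upwards [hyP' q, hη'.eventually_lt_const one_pos, h1] with j hj hj' hj1
    have h2 := hdist j _ hj p (hp j)
    rw [hα, hβ] at h2
    have h3 := dist_triangle (α j (y q j)) q q₀
    linarith [(abs_le.1 h2).1]
  choose S hS using hS
  have hiso : Isometry S := by
    refine Isometry.of_dist_eq fun q q' => ?_
    have h1 := hdiff (y q) (y q') (hyP' q) (hyP' q')
    have h2 := ((hyα' q).dist (hyα' q')).sub ((hS q).dist (hS q'))
    linarith [tendsto_nhds_unique h1 h2]
  -- Completeness of `Y` makes the image of `S` closed, so compactness of balls is inherited from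
  -- `V`.
  have hYproper : ProperSpace Y := by
    refine ⟨fun q r => ?_⟩
    rw [← hiso.preimage_closedBall]
    exact hiso.isClosedEmbedding.isCompact_preimage (isCompact_closedBall _ _)
  -- The value `S q` does not depend on the approximating sequence. Surjectivity, the base point and
  -- the final estimate all reduce to this.
  have hlim : ∀ (z : ℕ → X) (q : Y), (∀ᶠ j in (𝒰 : Filter ℕ), z j ∈ P j) →
      Tendsto (fun j => α j (z j)) 𝒰 (𝓝 q) → Tendsto (fun j => β j (z j)) 𝒰 (𝓝 (S q)) := by
    intro z q hz hzq
    have h1 := hdiff z (y q) hz (hyP' q)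
    have h2 := hzq.dist (hyα' q)
    rw [dist_self] at h2
    have h3 := h2.sub h1
    simp only [sub_sub_cancel, sub_zero] at h3
    have h4 := h3.add (tendsto_iff_dist_tendsto_zero.1 (hS q))
    rw [add_zero] at h4
    exact tendsto_iff_dist_tendsto_zero.2 (squeeze_zero (fun _ => dist_nonneg)
      (fun j => dist_triangle _ (β j (y q j)) _) h4)
  have hsurj : Function.Surjective S := by
    intro v
    obtain ⟨z, hz, hzv⟩ := hV v
    have hz' := hle hz
    have hzv' := hzv.mono_left hle
    obtain ⟨q, hq⟩ : ∃ q, Tendsto (fun j => α j (z j)) 𝒰 (𝓝 q) := by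
      refine exists_tendsto_of_dist_le (z₀ := q₀) (M := dist v v₀ + 1 + 1) ?_
      have h1 := (tendsto_iff_dist_tendsto_zero.1 hzv').eventually_lt_const one_pos
      filter_upwards [hz', hη'.eventually_lt_const one_pos, h1] with j hj hj' hj1
      have h2 := hdist j _ hj p (hp j)
      rw [hα, hβ] at h2
      have h3 := dist_triangle (β j (z j)) v v₀
      linarith [(abs_le.1 h2).2]
    exact ⟨q, tendsto_nhds_unique (hlim z q hz' hq) hzv'⟩
  refine ⟨IsometryEquiv.mk (Equiv.ofBijective S ⟨hiso.injective, hsurj⟩) hiso, ?_, ?_⟩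
  · have h1 := hlim (fun _ => p) q₀ (.of_forall hp) (by simp only [hα]; exact tendsto_const_nhds)
    simp only [hβ] at h1
    exact tendsto_nhds_unique h1 tendsto_const_nhds
  · intro M ε hε
    by_contra hcon
    -- Along an ultrafilter, failing to hold eventually means that the negation holds eventually;
    -- the bad points then have limits that contradict `hlim`.
    have hcon := Ultrafilter.eventually_not.2 hcon
    have hcon' : ∀ᶠ j in (𝒰 : Filter ℕ), ∃ z, z ∈ P j ∧ dist (α j z) q₀ ≤ M ∧
        ε ≤ dist (S (α j z)) (β j z) := by
      filter_upwards [hcon] with j hj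
      push Not at hj
      exact hj
    have : Nonempty X := ⟨p⟩
    obtain ⟨z, hz⟩ := hcon'.choice
    obtain ⟨q, hq⟩ := exists_tendsto_of_dist_le (hz.mono fun j hj => hj.2.1)
    have h1 := hlim z q (hz.mono fun j hj => hj.1) hq
    have h2 := ((hiso.continuous.tendsto q).comp hq).dist h1
    rw [dist_self] at h2
    obtain ⟨j, hj1, hj2⟩ := ((h2.eventually_lt_const hε).and hz).exists
    exact absurd hj1 (not_lt.2 hj2.2.2)

end GromovHausdorff

/-! ### Models of the blow-ups, and their membership in the tangent cone -/

section BlowUps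

variable {X : Type u} [MetricSpace X] [MeasurableSpace X]

/-- The maps `β s` are, up to errors that vanish with `s`, pointed measured Gromov-Hausdorff
approximations from the blow-ups at `p` with factor `1 / s` to `V`, on a Borel set `U` of full
density at `p`. -/
structure IsBlowUpModel (m : Measure X) (p : X) (U : Set X) (V : PointedMMS.{w})
    (β : ℝ → X → V.carrier) : Prop where
  measurableSet : MeasurableSet U
  mem : p ∈ U
  measurable : ∀ s, Measurable (β s)
  map_base : ∀ s, β s p = V.point
  dist_le : ∀ M : ℝ, ∀ δ > 0, ∀ᶠ s in 𝓝[>] (0 : ℝ), ∀ y ∈ U ∩ Metric.ball p (M * s),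
    ∀ z ∈ U ∩ Metric.ball p (M * s), |dist y z - s * dist (β s y) (β s z)| ≤ δ * s
  exists_dist_le : ∀ M : ℝ, ∀ δ > 0, ∀ᶠ s in 𝓝[>] (0 : ℝ), ∀ v, dist v V.point < M →
    ∃ y ∈ U ∩ Metric.ball p ((M + δ) * s), dist (β s y) v ≤ δ
  exists_dist_lt : ∀ M : ℝ, ∀ δ > 0, ∀ᶠ s in 𝓝[>] (0 : ℝ), ∀ y ∈ Metric.ball p (M * s),
    ∃ z ∈ U, dist y z < δ * s
  integral : ∀ R > 0, ∀ g : BoundedContinuousFunction V.carrier ℝ,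
    Tendsto (fun s => (m.real (Metric.ball p s))⁻¹ *
      ∫ y in Metric.ball p (R * s) ∩ U, g (β s y) ∂m) (𝓝[>] 0)
      (𝓝 (∫ v in Metric.ball V.point R, g v ∂V.measure))
  compl : ∀ R > 0, Tendsto (fun s => (m.real (Metric.ball p s))⁻¹ *
      m.real (Metric.ball p (R * s) \ U)) (𝓝[>] 0) (𝓝 0)

/-- A measurable map on a Borel set `U` is extended to a neighbourhood of `U` by almost nearest
points. -/
theorem exists_measurable_near [TopologicalSpace.SeparableSpace X] [OpensMeasurableSpace X]
    {Z : Type*} [MeasurableSpace Z] {U : Set X} (hU : MeasurableSet U) (hne : U.Nonempty)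
    {b : X → Z} (hb : Measurable b) {t : ℝ} (ht : 0 < t) :
    ∃ ψ : X → Z, Measurable ψ ∧ EqOn ψ b U ∧
      ∀ y, (∃ z ∈ U, dist y z < t) → ∃ z ∈ U, dist y z < t ∧ ψ y = b z := by
  classical
  have : SecondCountableTopology X := UniformSpace.secondCountable_of_separable X
  have : Nonempty U := hne.to_subtype
  obtain ⟨q, hq⟩ := TopologicalSpace.exists_dense_seq U
  let T : Set X := ⋃ n, Metric.ball (q n : X) t
  have hT : MeasurableSet T := MeasurableSet.iUnion fun n => Metric.isOpen_ball.measurableSet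
  -- The union with `Tᶜ` only makes the search for the first index total; points off `T` get index
  -- `0`.
  have hex : ∀ y, ∃ n, y ∈ Metric.ball (q n : X) t ∪ Tᶜ := by
    intro y
    by_cases hy : y ∈ T
    · obtain ⟨n, hn⟩ := mem_iUnion.1 hy
      exact ⟨n, .inl hn⟩
    · exact ⟨0, .inr hy⟩
  have hmeas : Measurable fun y => b (q (Nat.find (hex y))) :=
    Measurable.find (f := fun n _ => b (q n)) (p := fun n y => y ∈ Metric.ball (q n : X) t ∪ Tᶜ)
      (fun n => measurable_const)
      (fun n => (Metric.isOpen_ball.measurableSet.union hT.compl)) hex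
  refine ⟨U.piecewise b fun y => b (q (Nat.find (hex y))), hb.piecewise hU hmeas,
    piecewise_eqOn _ _ _, fun y hy => ?_⟩
  by_cases hyU : y ∈ U
  · exact ⟨y, hyU, by simpa using ht, piecewise_eq_of_mem _ _ _ hyU⟩
  · rw [piecewise_eq_of_notMem _ _ _ hyU]
    obtain ⟨z, hzU, hz⟩ := hy
    obtain ⟨n, hn⟩ := hq.exists_dist_lt (⟨z, hzU⟩ : U) (sub_pos.2 hz)
    have hyT : y ∈ T := by
      refine mem_iUnion.2 ⟨n, ?_⟩
      rw [Metric.mem_ball]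
      have h1 : dist z (q n : X) < t - dist y z := hn
      linarith [dist_triangle y z (q n : X)]
    have h2 := Nat.find_spec (hex y)
    exact ⟨_, (q (Nat.find (hex y))).2, h2.resolve_right fun h => h hyT, rfl⟩

theorem integral_normalised_map {X Y : Type*} [MeasurableSpace X] [MetricSpace Y]
    [MeasurableSpace Y] [BorelSpace Y] (m : Measure X) {B B' : Set X} {ψ : X → Y} (hψ : Measurable ψ)
    (f : BoundedContinuousFunction Y ℝ) :
    ∫ y, f y ∂((m B)⁻¹ • (m.restrict B').map ψ) = (m.real B)⁻¹ * ∫ x in B', f (ψ x) ∂m := by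
  rw [integral_smul_measure, integral_map hψ.aemeasurable f.continuous.aestronglyMeasurable,
    ENNReal.toReal_inv, smul_eq_mul]
  rfl

theorem BoundedlyFinite.integrableOn_comp [OpensMeasurableSpace X] {Y : Type*} [MetricSpace Y]
    [MeasurableSpace Y] [BorelSpace Y] {m : Measure X} (hfin : BoundedlyFinite m) {ψ : X → Y}
    (hψ : Measurable ψ)
    (f : BoundedContinuousFunction Y ℝ) {S : Set X} {p : X} {R : ℝ} (hS : S ⊆ Metric.ball p R) :
    IntegrableOn (fun x => f (ψ x)) S m := by
  have h1 : m S < ∞ := (measure_mono hS).trans_lt (hfin p R)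
  have : IsFiniteMeasure (m.restrict S) := ⟨by simpa using h1⟩
  exact Integrable.of_bound (f.continuous.measurable.comp hψ).aestronglyMeasurable ‖f‖
    (.of_forall fun x => f.norm_coe_le_norm _)

/-- The complement of a set contributes to an integral at most in proportion to its measure. -/
theorem BoundedlyFinite.abs_integral_sub_le [OpensMeasurableSpace X] {Y : Type*} [MetricSpace Y]
    [MeasurableSpace Y]
    [BorelSpace Y] {m : Measure X} (hfin : BoundedlyFinite m) {ψ : X → Y} (hψ : Measurable ψ)
    (f : BoundedContinuousFunction Y ℝ) {U : Set X} (hU : MeasurableSet U) (p : X) (R : ℝ) :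
    |∫ x in Metric.ball p R, f (ψ x) ∂m - ∫ x in Metric.ball p R ∩ U, f (ψ x) ∂m| ≤
      ‖f‖ * m.real (Metric.ball p R \ U) := by
  rw [← integral_inter_add_sdiff hU (hfin.integrableOn_comp hψ f subset_rfl), add_sub_cancel_left]
  exact norm_setIntegral_le_of_norm_le_const
    ((measure_mono sdiff_subset).trans_lt (hfin p R)) fun x _ => f.norm_coe_le_norm _

/-- A model of the blow-ups is a limit of them along every sequence of radii. -/
theorem IsBlowUpModel.blowUpsConverge [TopologicalSpace.SeparableSpace X] [OpensMeasurableSpace X]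
    {m : Measure X} (hfin : BoundedlyFinite m) {p : X} {U : Set X} {V : PointedMMS.{w}}
    {β : ℝ → X → V.carrier} (h : IsBlowUpModel m p U V β) {r : ℕ → ℝ} (hr0 : ∀ k, 0 < r k)
    (hr : Tendsto r atTop (𝓝 0)) : BlowUpsConverge m p r V := by
  intro ε hε
  refine .of_forall fun R hR => ?_
  obtain ⟨hε0, hε1⟩ := hε
  have hr' : Tendsto r atTop (𝓝[>] 0) := tendsto_nhdsWithin_iff.2 ⟨hr, .of_forall hr0⟩
  have hδ : 0 < ε / 4 := by positivity
  -- Radius `R + 1` leaves room for the almost nearest points. Radius `R - ε` with error `ε / 4`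
  -- keeps the preimages of model points inside the ball of radius `R`.
  obtain ⟨k₀, hk₀⟩ := eventually_atTop.1 (hr'.eventually ((h.dist_le (R + 1) _ hδ).and
    ((h.exists_dist_le (R - ε) _ hδ).and (h.exists_dist_lt R _ hδ))))
  choose ψ hψm hψU hψ using fun k => exists_measurable_near h.measurableSet ⟨p, h.mem⟩
    (h.measurable (r k)) (mul_pos hδ (hr0 k))
  refine ⟨k₀, ψ, fun k _ => hψm k, fun k _ => ?_, fun k hk => ?_, fun k hk => ?_, fun f _ => ?_⟩
  · rw [hψU k h.mem, h.map_base]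
  · obtain ⟨h1, -, h3⟩ := hk₀ k hk
    intro y hy z hz
    obtain ⟨y', hy'U, hy', hyψ⟩ := hψ k y (h3 y hy)
    obtain ⟨z', hz'U, hz', hzψ⟩ := hψ k z (h3 z hz)
    rw [hyψ, hzψ]
    have hin : ∀ x x' : X, x ∈ Metric.ball p (R * r k) → dist x x' < ε / 4 * r k →
        x' ∈ Metric.ball p ((R + 1) * r k) := by
      intro x x' hx hxx
      rw [Metric.mem_ball] at hx ⊢
      have := dist_triangle_left x' p x
      nlinarith [hr0 k]
    have h4 := abs_le.1 (h1 y' ⟨hy'U, hin y y' hy hy'⟩ z' ⟨hz'U, hin z z' hz hz'⟩)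
    have h5 : |dist y z - dist y' z'| ≤ dist y y' + dist z z' := by
      rw [← Real.dist_eq]; exact dist_dist_dist_le y z y' z'
    have h6 := abs_le.1 h5
    rw [abs_le]
    constructor <;> linarith
  · obtain ⟨-, h2, -⟩ := hk₀ k hk
    intro v hv
    obtain ⟨y, ⟨hyU, hy⟩, hyv⟩ := h2 v hv
    rw [Metric.mem_thickening_iff]
    refine ⟨ψ k y, ⟨y, Metric.ball_subset_ball ?_ hy, rfl⟩, ?_⟩
    · nlinarith [hr0 k]
    · rw [hψU k hyU, dist_comm]; linarith
  · have h1 := (h.integral R (by linarith) f).comp hr'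
    have h2 := ((h.compl R (by linarith)).comp hr').const_mul ‖f‖
    rw [mul_zero] at h2
    refine (tendsto_congr fun k => integral_normalised_map m (hψm k) f).2 ?_
    refine tendsto_of_tendsto_of_dist h1 (squeeze_zero (fun _ => dist_nonneg) (fun k => ?_) h2)
    have h3 : ∫ x in Metric.ball p (R * r k) ∩ U, f (β (r k) x) ∂m =
        ∫ x in Metric.ball p (R * r k) ∩ U, f (ψ k x) ∂m :=
      setIntegral_congr_fun (Metric.isOpen_ball.measurableSet.inter h.measurableSet)
        fun x hx => by simp only [hψU k hx.2]
    have h4 := hfin.abs_integral_sub_le (hψm k) f h.measurableSet p (R * r k)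
    simp only [Function.comp_apply]
    rw [h3, dist_comm, Real.dist_eq, ← mul_sub, abs_mul, abs_of_nonneg (by positivity),
      mul_left_comm]
    exact mul_le_mul_of_nonneg_left h4 (by positivity)

theorem IsBlowUpModel.mem_tangentCone [TopologicalSpace.SeparableSpace X] [OpensMeasurableSpace X]
    {m : Measure X} (hfin : BoundedlyFinite m) {p : X} {U : Set X} {V : PointedMMS.{w}}
    {β : ℝ → X → V.carrier} (h : IsBlowUpModel m p U V β) : V ∈ TangentCone m p :=
  ⟨fun k : ℕ => 1 / ((k : ℝ) + 1), fun _ => by positivity,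
    fun _ _ hkl => one_div_le_one_div_of_le (by positivity) (by gcongr),
    tendsto_one_div_add_atTop_nhds_zero_nat, h.blowUpsConverge hfin (fun _ => by positivity)
      tendsto_one_div_add_atTop_nhds_zero_nat⟩

end BlowUps

/-! ### Uniqueness of the tangent -/

section Uniqueness

variable {X : Type u} [MetricSpace X] [MeasurableSpace X]

/-- A diagonal choice of scales and approximations in a convergent sequence of blow-ups. -/
theorem BlowUpsConverge.exists_diagonal {m : Measure X} {p : X} {r : ℕ → ℝ} {Y : PointedMMS.{v}}
    (hr0 : ∀ k, 0 < r k) (hr : Tendsto r atTop (𝓝 0)) (hconv : BlowUpsConverge m p r Y)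
    (f : BoundedContinuousFunction Y.carrier ℝ) (hf : Bornology.IsBounded (Function.support f))
    {ε : ℝ} (hε : ε ∈ Ioo (0 : ℝ) 1) {a : ℝ} (ha : 1 ≤ a) {E : ℝ → Prop}
    (hE : ∀ᶠ s in 𝓝[>] (0 : ℝ), E s) :
    ∃ (R s : ℝ) (ψ : X → Y.carrier), R ∈ Ioo a (a + 1) ∧ 0 < s ∧ E s ∧ Measurable ψ ∧
      ψ p = Y.point ∧
      (∀ x ∈ Metric.ball p (R * s), ∀ y ∈ Metric.ball p (R * s),
        |dist x y - s * dist (ψ x) (ψ y)| ≤ ε * s) ∧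
      Metric.ball Y.point (R - ε) ⊆ Metric.thickening ε (ψ '' Metric.ball p (R * s)) ∧
      |(m.real (Metric.ball p s))⁻¹ * ∫ x in Metric.ball p (R * s), f (ψ x) ∂m -
        ∫ y in Metric.ball Y.point R, f y ∂Y.measure| ≤ ε := by
  -- The interval has positive length, so it contains an admissible radius `R`.
  have hne : (ae ((volume : Measure ℝ).restrict (Ioo a (a + 1)))).NeBot := by
    rw [ae_neBot, Ne, Measure.restrict_eq_zero, Real.volume_Ioo]
    simp
  obtain ⟨R, hR, hRmem⟩ := ((ae_restrict_of_ae (hconv ε hε)).and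
    (ae_restrict_mem (measurableSet_Ioo (a := a) (b := a + 1)))).exists
  obtain ⟨k₀, ψ, h1, h2, h3, h4, h5⟩ := hR (ha.trans_lt hRmem.1)
  have hr' : Tendsto r atTop (𝓝[>] 0) := tendsto_nhdsWithin_iff.2 ⟨hr, .of_forall hr0⟩
  obtain ⟨k, ⟨hk, hkE⟩, hk0⟩ := (((Metric.tendsto_nhds.1 (h5 f hf) ε hε.1).and
    (hr'.eventually hE)).and (eventually_ge_atTop k₀)).exists
  refine ⟨R, r k, ψ k, hRmem, hr0 k, hkE, h1 k hk0, h2 k hk0, h3 k hk0, h4 k hk0, ?_⟩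
  rw [integral_normalised_map m (h1 k hk0), Real.dist_eq] at hk
  exact hk.le

/-- A limit of blow-ups is isometric to a proper model of them, by an isometry that preserves the
integral of a given function. -/
theorem IsBlowUpModel.exists_isometryEquiv [OpensMeasurableSpace X] {m : Measure X}
    (hfin : BoundedlyFinite m) {p : X} {U : Set X} {V : PointedMMS.{w}} [ProperSpace V.carrier]
    {β : ℝ → X → V.carrier} (h : IsBlowUpModel m p U V β) {Y : PointedMMS.{v}}
    (hY : Y ∈ TangentCone m p) (f : BoundedContinuousFunction Y.carrier ℝ)
    (hf : Bornology.IsBounded (Function.support f)) :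
    ∃ e : Y.carrier ≃ᵢ V.carrier, e Y.point = V.point ∧
      ∫ y, f y ∂Y.measure = ∫ v, f (e.symm v) ∂V.measure := by
  obtain ⟨r, hr0, -, hr, hconv⟩ := hY
  have hεpos : ∀ j : ℕ, (0 : ℝ) < 1 / ((j : ℝ) + 1) / 4 := fun j => by positivity
  set ε : ℕ → ℝ := fun j => 1 / ((j : ℝ) + 1) / 4 with hεdef
  have hεle : ∀ j, ε j ≤ 1 / 4 := fun j => by
    rw [hεdef]
    refine div_le_div_of_nonneg_right ?_ (by norm_num)
    rw [div_le_one (by positivity)]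
    linarith [(Nat.cast_nonneg j : (0 : ℝ) ≤ j)]
  have hεlim : Tendsto ε atTop (𝓝 0) := by
    have := (tendsto_one_div_add_atTop_nhds_zero_nat (𝕜 := ℝ)).div_const 4
    rwa [zero_div] at this
  -- The radii `R j` will lie in `(j + 3, j + 4)`: the almost isometry holds on a larger ball, and
  -- the points that reach the model ball of radius `j + 2` lie in a smaller one.
  have hE : ∀ j : ℕ, ∀ᶠ s in 𝓝[>] (0 : ℝ), s ∈ Ioo (0 : ℝ) (ε j) ∧
      (∀ y ∈ U ∩ Metric.ball p ((j + 4 : ℝ) * s), ∀ z ∈ U ∩ Metric.ball p ((j + 4 : ℝ) * s),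
        |dist y z - s * dist (β s y) (β s z)| ≤ ε j * s) ∧
      (∀ v, dist v V.point < (j + 2 : ℝ) →
        ∃ y ∈ U ∩ Metric.ball p ((j + 2 + ε j : ℝ) * s), dist (β s y) v ≤ ε j) ∧
      ∀ y ∈ Metric.ball p ((j + 4 : ℝ) * s), ∃ z ∈ U, dist y z < ε j * s := fun j =>
    (show ∀ᶠ s in 𝓝[>] (0 : ℝ), s ∈ Ioo 0 (ε j) from Ioo_mem_nhdsGT (hεpos j)).and ((h.dist_le _ _ (hεpos j)).and
      ((h.exists_dist_le _ _ (hεpos j)).and (h.exists_dist_lt _ _ (hεpos j))))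
  choose R s ψ hR hs0 hs hψm hψp hψd hψn hψi using fun j => hconv.exists_diagonal hr0 hr f hf
    (ε := ε j) ⟨hεpos j, (hεle j).trans_lt (by norm_num)⟩ (a := (j : ℝ) + 3)
    (by linarith [(Nat.cast_nonneg j : (0 : ℝ) ≤ j)]) (hE j)
  have hslim : Tendsto s atTop (𝓝[>] 0) := tendsto_nhdsWithin_iff.2
    ⟨squeeze_zero (fun j => (hs0 j).le) (fun j => (hs j).1.2.le) hεlim, .of_forall hs0⟩
  have hRlim : Tendsto R atTop atTop :=
    tendsto_atTop_mono (fun j => by linarith [(hR j).1]) tendsto_natCast_atTop_atTop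
  have hRlt : ∀ j, Metric.ball p (R j * s j) ⊆ Metric.ball p ((j + 4 : ℝ) * s j) := fun j =>
    Metric.ball_subset_ball (mul_le_mul_of_nonneg_right (by linarith [(hR j).2]) (hs0 j).le)
  have hpball : ∀ j, p ∈ Metric.ball p (R j * s j) := fun j => by
    refine Metric.mem_ball_self (mul_pos ?_ (hs0 j))
    linarith [(hR j).1, (Nat.cast_nonneg j : (0 : ℝ) ≤ j)]
  have hlower : ∀ j, ∀ y ∈ Metric.ball p (R j * s j),
      dist y p ≤ s j * (dist (ψ j y) Y.point + ε j) := fun j y hy => by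
    have := hψd j y hy p (hpball j)
    rw [hψp] at this
    linarith [(abs_le.1 this).2]
  -- Both `ψ j` and `β (s j)` distort the rescaled metric of `X` by at most `ε j`, so they differ
  -- from each other by at most `2 * ε j`.
  obtain ⟨e, he0, he⟩ := exists_isometryEquiv_of_correspondences (η := fun j => 2 * ε j)
    (P := fun j => U ∩ Metric.ball p (R j * s j)) (α := ψ) (β := fun j => β (s j)) (p := p)
    (q₀ := Y.point) (v₀ := V.point) (by simpa using hεlim.const_mul 2)
    (fun j y hy z hz => by
      have h1 := abs_le.1 (hψd j y hy.2 z hz.2)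
      have h2 := abs_le.1 ((hs j).2.1 y ⟨hy.1, hRlt j hy.2⟩ z ⟨hz.1, hRlt j hz.2⟩)
      have h3 := hs0 j
      rw [abs_le]
      constructor <;> refine le_of_mul_le_mul_left ?_ h3 <;> linarith)
    (fun j => ⟨h.mem, hpball j⟩) hψp (fun j => h.map_base _)
    (fun q => by
      have : Nonempty X := ⟨p⟩
      have hev : ∀ᶠ j in atTop, ∃ z, z ∈ U ∩ Metric.ball p (R j * s j) ∧
          dist (ψ j z) q ≤ 3 * ε j := by
        filter_upwards [hRlim.eventually_gt_atTop (dist q Y.point + 1)] with j hj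
        have hε4 := hεle j
        have hs0j := hs0 j
        obtain ⟨_, ⟨y, hy, rfl⟩, hqy⟩ := Metric.mem_thickening_iff.1
          (hψn j (show q ∈ Metric.ball Y.point (R j - ε j) by rw [Metric.mem_ball]; linarith))
        obtain ⟨z, hzU, hyz⟩ := (hs j).2.2.2 y (hRlt j hy)
        have hz : z ∈ Metric.ball p (R j * s j) := by
          have h1 := hlower j y hy
          have h2 := dist_triangle_left (ψ j y) Y.point q
          have h3 := dist_triangle_left z p y
          rw [Metric.mem_ball]
          nlinarith
        refine ⟨z, ⟨hzU, hz⟩, ?_⟩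
        have h4 := (abs_le.1 (hψd j y hy z hz)).1
        have h5 : dist (ψ j y) (ψ j z) ≤ 2 * ε j := by
          refine le_of_mul_le_mul_left ?_ hs0j
          linarith
        have h6 := dist_triangle_left (ψ j z) q (ψ j y)
        rw [dist_comm (ψ j y) q] at h6
        linarith
      obtain ⟨z, hz⟩ := hev.choice
      refine ⟨z, hz.mono fun j hj => hj.1, tendsto_iff_dist_tendsto_zero.2 ?_⟩
      exact squeeze_zero' (.of_forall fun _ => dist_nonneg) (hz.mono fun j hj => hj.2)
        (by simpa using hεlim.const_mul 3))
    (fun v => by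
      have : Nonempty X := ⟨p⟩
      have hev : ∀ᶠ j in atTop, ∃ z, z ∈ U ∩ Metric.ball p (R j * s j) ∧
          dist (β (s j) z) v ≤ ε j := by
        filter_upwards [tendsto_natCast_atTop_atTop.eventually_gt_atTop (dist v V.point)] with j hj
        obtain ⟨y, ⟨hyU, hy⟩, hyv⟩ := (hs j).2.2.1 v (by linarith)
        refine ⟨y, ⟨hyU, Metric.ball_subset_ball ?_ hy⟩, hyv⟩
        exact mul_le_mul_of_nonneg_right (by linarith [(hR j).1, hεle j]) (hs0 j).le
      obtain ⟨z, hz⟩ := hev.choice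
      refine ⟨z, hz.mono fun j hj => hj.1, tendsto_iff_dist_tendsto_zero.2 ?_⟩
      exact squeeze_zero' (.of_forall fun _ => dist_nonneg) (hz.mono fun j hj => hj.2) hεlim)
  refine ⟨e, he0, ?_⟩
  obtain ⟨M₀, hM₀, hsupp⟩ : ∃ M₀ > 0, Function.support f ⊆ Metric.ball Y.point M₀ := by
    obtain ⟨M, hM⟩ := hf.subset_ball Y.point
    exact ⟨max M 1, by positivity, hM.trans (Metric.ball_subset_ball (le_max_left _ _))⟩
  -- The extra unit absorbs the distortion: `f ∘ ψ j` vanishes on the large ball outside the ball of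
  -- radius `M * s j`.
  set M := M₀ + 1 with hM
  have hM0 : 0 < M := by linarith
  set g : BoundedContinuousFunction V.carrier ℝ :=
    f.compContinuous ⟨e.symm, e.symm.continuous⟩ with hg
  have hgapp : ∀ v, g v = f (e.symm v) := fun v => rfl
  have hgf : ∀ y, g (e y) = f y := fun y => by rw [hgapp, e.symm_apply_apply]
  have hgsupp : Function.support g ⊆ Metric.ball V.point M₀ := by
    intro v hv
    have h1 := hsupp (show e.symm v ∈ Function.support f from hv)
    rw [Metric.mem_ball] at h1 ⊢
    rwa [← e.apply_symm_apply v, ← he0, e.dist_eq]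
  have hgunif : UniformContinuous g := by
    refine HasCompactSupport.uniformContinuous_of_continuous ?_ g.continuous
    exact (Metric.isBounded_ball.subset hgsupp).isCompact_closure
  set c : ℕ → ℝ := fun j => (m.real (Metric.ball p (s j)))⁻¹ with hc
  have hc0 : ∀ j, 0 ≤ c j := fun j => inv_nonneg.2 measureReal_nonneg
  have hle : (hyperfilter ℕ : Filter ℕ) ≤ atTop := Nat.hyperfilter_le_atTop
  have hI : Tendsto (fun j => c j * ∫ x in Metric.ball p (R j * s j), f (ψ j x) ∂m) atTop
      (𝓝 (∫ y, f y ∂Y.measure)) := by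
    refine tendsto_iff_dist_tendsto_zero.2 (squeeze_zero' (.of_forall fun _ => dist_nonneg) ?_
      hεlim)
    filter_upwards [hRlim.eventually_ge_atTop M₀] with j hj
    rw [Real.dist_eq, ← setIntegral_eq_integral_of_forall_compl_eq_zero
      (s := Metric.ball Y.point (R j))]
    · exact hψi j
    · intro y hy
      by_contra hne
      exact hy (Metric.ball_subset_ball hj (hsupp hne))
  have hI' : Tendsto (fun j => c j * ∫ x in Metric.ball p (M * s j) ∩ U, f (ψ j x) ∂m) atTop
      (𝓝 (∫ y, f y ∂Y.measure)) := by
    have h2 := ((h.compl M hM0).comp hslim).const_mul ‖f‖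
    rw [mul_zero] at h2
    refine tendsto_of_tendsto_of_dist hI (squeeze_zero' (.of_forall fun _ => dist_nonneg) ?_ h2)
    filter_upwards [hRlim.eventually_ge_atTop M] with j hj
    have hsub : Metric.ball p (M * s j) ⊆ Metric.ball p (R j * s j) :=
      Metric.ball_subset_ball (mul_le_mul_of_nonneg_right hj (hs0 j).le)
    have h3 : ∫ x in Metric.ball p (R j * s j), f (ψ j x) ∂m =
        ∫ x in Metric.ball p (M * s j), f (ψ j x) ∂m := by
      refine setIntegral_eq_of_subset_of_forall_sdiff_eq_zero Metric.isOpen_ball.measurableSet hsub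
        fun x hx => ?_
      by_contra hne
      have h4 := hsupp hne
      have h5 := hlower j x hx.1
      refine hx.2 ?_
      rw [Metric.mem_ball] at h4 ⊢
      have := hs0 j
      have := hεle j
      nlinarith
    have h4 := hfin.abs_integral_sub_le (hψm j) f h.measurableSet p (M * s j)
    simp only [Function.comp_apply]
    rw [h3, Real.dist_eq, ← mul_sub, abs_mul, abs_of_nonneg (hc0 j), mul_left_comm]
    exact mul_le_mul_of_nonneg_left h4 (hc0 j)
  have hJ : Tendsto (fun j => c j * ∫ x in Metric.ball p (M * s j) ∩ U, g (β (s j) x) ∂m) atTop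
      (𝓝 (∫ v, g v ∂V.measure)) := by
    rw [← setIntegral_eq_integral_of_forall_compl_eq_zero (s := Metric.ball V.point M)]
    · exact (h.integral M hM0 g).comp hslim
    · intro y hy
      by_contra hne
      exact hy (Metric.ball_subset_ball (by linarith) (hgsupp hne))
  have hK := (h.integral M hM0 (BoundedContinuousFunction.const _ 1)).comp hslim
  set K := ∫ v in Metric.ball V.point M, (BoundedContinuousFunction.const V.carrier (1 : ℝ)) v
    ∂V.measure
  -- Here `f (ψ j x) = g (e (ψ j x))`, and `e (ψ j x)` is uniformly close to `β (s j) x` along the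
  -- ultrafilter. Uniform continuity of `g` and the bound `K + 1` on the normalised masses conclude.
  have hdiff : Tendsto (fun j => c j * ∫ x in Metric.ball p (M * s j) ∩ U, f (ψ j x) ∂m -
      c j * ∫ x in Metric.ball p (M * s j) ∩ U, g (β (s j) x) ∂m) (hyperfilter ℕ) (𝓝 0) := by
    rw [Metric.tendsto_nhds]
    intro κ hκ
    have hK0 : 0 ≤ K := integral_nonneg fun _ => zero_le_one
    obtain ⟨δ, hδ, hδg⟩ := Metric.uniformContinuous_iff.1 hgunif (κ / (K + 1) / 2) (by positivity)
    filter_upwards [he (M + 1) δ hδ, hle (hRlim.eventually_ge_atTop M),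
      hle (hK.eventually_lt_const (lt_add_one K))] with j hj hRj hKj
    have hsub : Metric.ball p (M * s j) ⊆ Metric.ball p (R j * s j) :=
      Metric.ball_subset_ball (mul_le_mul_of_nonneg_right hRj (hs0 j).le)
    simp only [Function.comp_apply, BoundedContinuousFunction.const_apply, setIntegral_const,
      smul_eq_mul, mul_one] at hKj
    have hlt : m (Metric.ball p (M * s j) ∩ U) < ∞ :=
      (measure_mono inter_subset_left).trans_lt (hfin _ _)
    have h1 : ‖∫ x in Metric.ball p (M * s j) ∩ U, (f (ψ j x) - g (β (s j) x)) ∂m‖ ≤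
        κ / (K + 1) / 2 * m.real (Metric.ball p (M * s j) ∩ U) := by
      refine norm_setIntegral_le_of_norm_le_const hlt fun x hx => ?_
      rw [← hgf, ← dist_eq_norm]
      refine (hδg (hj x ⟨hx.2, hsub hx.1⟩ ?_)).le
      have h2 := (abs_le.1 (hψd j x (hsub hx.1) p (hpball j))).1
      rw [hψp] at h2
      have h3 : dist x p < M * s j := hx.1
      refine le_of_mul_le_mul_left ?_ (hs0 j)
      nlinarith [hs0 j, hεle j]
    rw [dist_zero_right, ← mul_sub, ← integral_sub
      (hfin.integrableOn_comp (hψm j) f inter_subset_left)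
      (hfin.integrableOn_comp (h.measurable (s j)) g inter_subset_left), norm_mul,
      Real.norm_of_nonneg (hc0 j)]
    calc c j * ‖∫ x in Metric.ball p (M * s j) ∩ U, (f (ψ j x) - g (β (s j) x)) ∂m‖
        ≤ c j * (κ / (K + 1) / 2 * m.real (Metric.ball p (M * s j) ∩ U)) :=
          mul_le_mul_of_nonneg_left h1 (hc0 j)
      _ = κ / (K + 1) / 2 * (c j * m.real (Metric.ball p (M * s j) ∩ U)) := by ring
      _ ≤ κ / (K + 1) / 2 * (K + 1) := mul_le_mul_of_nonneg_left hKj.le (by positivity)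
      _ < κ := by field_simp; linarith
  have hfinal := (hI'.mono_left hle).sub (hJ.mono_left hle)
  exact sub_eq_zero.1 (tendsto_nhds_unique hfinal hdiff)

/-- A proper model whose measure is preserved by its isometries is, up to isomorphism, the only
element of the tangent cone. -/
theorem IsBlowUpModel.iso [OpensMeasurableSpace X] {m : Measure X} (hfin : BoundedlyFinite m)
    {p : X} {U : Set X} {V : PointedMMS.{w}} [ProperSpace V.carrier] {β : ℝ → X → V.carrier}
    (h : IsBlowUpModel m p U V β)
    (hinv : ∀ e : V.carrier ≃ᵢ V.carrier, V.measure.map e = V.measure)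
    {Y : PointedMMS.{v}} (hY : Y ∈ TangentCone m p) : Y.Iso V := by
  -- The zero test function is used only to obtain some isometry `e`. A test function `g` later
  -- yields another one, `e'`, and `e ∘ e'⁻¹` is an isometry of the model, which `hinv` removes.
  obtain ⟨e, he, -⟩ := h.exists_isometryEquiv hfin hY 0 (by simp)
  refine ⟨e, he, ?_⟩
  have hloc : ∀ {μ : Measure V.carrier}, BoundedlyFinite μ → IsLocallyFiniteMeasure μ :=
    fun hμ => ⟨fun x => ⟨_, Metric.ball_mem_nhds x one_pos, hμ x 1⟩⟩
  have := hloc V.boundedlyFinite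
  have : IsLocallyFiniteMeasure (Y.measure.map e) := hloc fun x r => by
    rw [Measure.map_apply e.continuous.measurable Metric.isOpen_ball.measurableSet,
      ← e.apply_symm_apply x, e.isometry.preimage_ball]
    exact Y.boundedlyFinite _ _
  refine Measure.ext_of_integral_eq_on_compactlySupported fun g => ?_
  have hsupp : Bornology.IsBounded (Function.support g) :=
    g.hasCompactSupport.isBounded.subset (subset_tsupport g)
  have hgc : Continuous (g : V.carrier → ℝ) := g.continuous
  obtain ⟨C, hC⟩ := g.hasCompactSupport.exists_bound_of_continuous hgc
  let f : BoundedContinuousFunction Y.carrier ℝ :=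
    .ofNormedAddCommGroup (fun y => g (e y)) (hgc.comp e.continuous) C fun y => hC _
  have hf : Bornology.IsBounded (Function.support f) := by
    have h1 : Function.support f = e ⁻¹' Function.support g := rfl
    rw [h1, ← e.image_symm]
    exact e.symm.isometry.lipschitz.isBounded_image hsupp
  obtain ⟨e', -, h2⟩ := h.exists_isometryEquiv hfin hY f hf
  rw [integral_map e.continuous.measurable.aemeasurable hgc.aestronglyMeasurable]
  calc ∫ y, g (e y) ∂Y.measure = ∫ v, g ((e'.symm.trans e) v) ∂V.measure := h2
    _ = ∫ v, g v ∂(V.measure.map (e'.symm.trans e)) :=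
      (integral_map (e'.symm.trans e).continuous.measurable.aemeasurable
        hgc.aestronglyMeasurable).symm
    _ = ∫ v, g v ∂V.measure := by rw [hinv]

end Uniqueness

/-! ### Density points in doubling spaces -/

section Density

/-- At almost every point of a set, the set is asymptotically dense in small balls. -/
theorem ae_exists_dist_le_of_doubling {α : Type*} [PseudoMetricSpace α] [MeasurableSpace α]
    (μ : Measure α) [IsUnifLocDoublingMeasure μ] [SecondCountableTopology α] [BorelSpace α]
    [IsLocallyFiniteMeasure μ] (S : Set α) :
    ∀ᵐ x ∂μ.restrict S, ∀ M : ℝ, ∀ δ > 0, ∀ᶠ r in 𝓝[>] (0 : ℝ), ∀ y, dist y x ≤ M * r →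
      ∃ z ∈ S, dist y z ≤ δ * r := by
  have h := ae_all_iff.2 fun k : ℕ =>
    IsUnifLocDoublingMeasure.ae_tendsto_measure_inter_div μ S (k : ℝ)
  filter_upwards [h] with x hx M δ hδ
  obtain ⟨k, hk⟩ := exists_nat_ge (M / δ)
  rw [div_le_iff₀ hδ] at hk
  -- This filter gives density of `S` in the balls of radius `δ * r` uniformly in their centres `y`.
  -- A ball missing `S` would have ratio `0` instead of nearly `1`.
  have htend := hx k (l := (𝓝[>] (0 : ℝ) ×ˢ ⊤) ⊓ 𝓟 {q : ℝ × α | dist q.2 x ≤ M * q.1})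
    (fun q => q.2) (fun q => δ * q.1) ?_ ?_
  · have hev := htend.eventually_ne one_ne_zero
    rw [eventually_inf_principal, ← principal_univ, eventually_prod_principal_iff] at hev
    filter_upwards [hev] with r hr y hy
    have h1 := hr y (mem_univ y) hy
    obtain ⟨z, hzS, hz⟩ : (S ∩ Metric.closedBall y (δ * r)).Nonempty := by
      by_contra hne
      rw [not_nonempty_iff_eq_empty] at hne
      simp [hne] at h1
    exact ⟨z, hzS, by rwa [dist_comm]⟩
  · refine Tendsto.mono_left ?_ inf_le_left
    refine Tendsto.comp (y := 𝓝[>] (0 : ℝ)) (g := fun r => δ * r) ?_ tendsto_fst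
    refine tendsto_nhdsWithin_iff.2 ⟨?_, ?_⟩
    · have : Tendsto (fun r : ℝ => δ * r) (𝓝 0) (𝓝 (δ * 0)) := tendsto_id.const_mul δ
      rw [mul_zero] at this
      exact this.mono_left nhdsWithin_le_nhds
    · filter_upwards [self_mem_nhdsWithin] with r (hr : 0 < r)
      exact mul_pos hδ hr
  · rw [eventually_inf_principal, ← principal_univ, eventually_prod_principal_iff]
    filter_upwards [self_mem_nhdsWithin] with r (hr : 0 < r) y _ hy
    rw [Metric.mem_closedBall, dist_comm]
    refine le_trans (show dist y x ≤ M * r from hy) ?_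
    nlinarith

variable {X : Type u} [MetricSpace X] [MeasurableSpace X]

theorem BoundedlyFinite.isLocallyFiniteMeasure {m : Measure X} (hfin : BoundedlyFinite m) :
    IsLocallyFiniteMeasure m :=
  ⟨fun x => ⟨_, Metric.ball_mem_nhds x one_pos, hfin x 1⟩⟩

theorem measure_ball_two_pow_mul_le {m : Measure X} {C : ℝ≥0}
    (hC : ∀ (x : X) (r : ℝ), 0 < r →
      m (Metric.ball x (2 * r)) ≤ (C : ℝ≥0∞) * m (Metric.ball x r)) (x : X) {r : ℝ} (hr : 0 < r)
    (k : ℕ) : m (Metric.ball x (2 ^ k * r)) ≤ (C : ℝ≥0∞) ^ k * m (Metric.ball x r) := by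
  induction k with
  | zero => simp
  | succ k ih =>
    rw [pow_succ', pow_succ', mul_assoc, mul_assoc]
    exact (hC x _ (by positivity)).trans (mul_le_mul_right ih _)

theorem IsDoubling.isUnifLocDoublingMeasure {m : Measure X} (hm : IsDoubling m) :
    IsUnifLocDoublingMeasure m := by
  obtain ⟨C, -, hC⟩ := hm
  refine ⟨⟨C ^ 2, ?_⟩⟩
  filter_upwards [self_mem_nhdsWithin] with r (hr : 0 < r) x
  calc m (Metric.closedBall x (2 * r)) ≤ m (Metric.ball x (2 ^ 2 * r)) :=
        measure_mono (Metric.closedBall_subset_ball (by linarith))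
    _ ≤ (C : ℝ≥0∞) ^ 2 * m (Metric.ball x r) := measure_ball_two_pow_mul_le hC x hr 2
    _ ≤ (C ^ 2 : ℝ≥0) * m (Metric.closedBall x r) := by
        rw [ENNReal.coe_pow]
        exact mul_le_mul_right (measure_mono Metric.ball_subset_closedBall) _

/-- Doubling propagates nullity of one ball to its dyadic enlargements, which exhaust the space. -/
theorem IsDoubling.measure_ball_pos {m : Measure X} (hm : IsDoubling m) (hne : m ≠ 0) (x : X)
    {r : ℝ} (hr : 0 < r) : 0 < m (Metric.ball x r) := by
  obtain ⟨C, -, hC⟩ := hm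
  refine pos_iff_ne_zero.2 fun h0 => hne (Measure.measure_univ_eq_zero.1 ?_)
  have hcover : (univ : Set X) ⊆ ⋃ k : ℕ, Metric.ball x (2 ^ k * r) := by
    intro y _
    obtain ⟨k, hk⟩ := pow_unbounded_of_one_lt (dist y x / r) (one_lt_two (α := ℝ))
    exact mem_iUnion.2 ⟨k, by rwa [Metric.mem_ball, ← div_lt_iff₀ hr]⟩
  refine measure_mono_null hcover (measure_iUnion_null fun k => ?_)
  have := measure_ball_two_pow_mul_le hC x hr k
  rwa [h0, mul_zero, nonpos_iff_eq_zero] at this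

/-- At almost every point of a Borel set, the complement has density zero. -/
theorem IsDoubling.ae_tendsto_measureReal_diff [TopologicalSpace.SeparableSpace X] [BorelSpace X]
    {m : Measure X} (hm : IsDoubling m) (hfin : BoundedlyFinite m) {U : Set X}
    (hU : MeasurableSet U) :
    ∀ᵐ x ∂m.restrict U, ∀ R > 0, Tendsto (fun s => (m.real (Metric.ball x s))⁻¹ *
      m.real (Metric.ball x (R * s) \ U)) (𝓝[>] 0) (𝓝 0) := by
  rcases eq_or_ne m 0 with rfl | hne
  · simp
  have : SecondCountableTopology X := UniformSpace.secondCountable_of_separable X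
  have := hfin.isLocallyFiniteMeasure
  have := hm.isUnifLocDoublingMeasure
  have h := IsUnifLocDoublingMeasure.ae_tendsto_measure_inter_div.{_, 0} m U 1
  filter_upwards [h] with x hx R hR
  have hpos := fun {s : ℝ} (hs : 0 < s) => hm.measure_ball_pos hne x hs
  obtain ⟨C, -, hC⟩ := hm
  have hlim : Tendsto (fun s : ℝ => R * s) (𝓝[>] 0) (𝓝[>] 0) := by
    refine tendsto_nhdsWithin_iff.2 ⟨?_, ?_⟩
    · have : Tendsto (fun r : ℝ => R * r) (𝓝 0) (𝓝 (R * 0)) := tendsto_id.const_mul R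
      rw [mul_zero] at this
      exact this.mono_left nhdsWithin_le_nhds
    · filter_upwards [self_mem_nhdsWithin] with r (hr : 0 < r)
      exact mul_pos hR hr
  have h1 := hx (fun _ : ℝ => x) (fun s => R * s) hlim (by
    filter_upwards [self_mem_nhdsWithin] with r (hr : 0 < r)
    exact Metric.mem_closedBall_self (by positivity))
  have h2 := ((ENNReal.continuousAt_toReal ENNReal.one_ne_top).tendsto.comp h1).const_sub 1
  -- With `R < 2 ^ k`, `k` doublings compare the ball of radius `R * s` with the normalising ball of
  -- radius `s`.
  obtain ⟨k, hk⟩ := pow_unbounded_of_one_lt R (one_lt_two (α := ℝ))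
  have h3 := h2.const_mul ((C : ℝ) ^ k)
  rw [ENNReal.toReal_one, sub_self, mul_zero] at h3
  refine squeeze_zero' (.of_forall fun s => by positivity) ?_ h3
  filter_upwards [self_mem_nhdsWithin] with s (hs : 0 < s)
  have hfinc : m (Metric.closedBall x (R * s)) ≠ ∞ :=
    ((measure_mono (Metric.closedBall_subset_ball (lt_add_one _))).trans_lt (hfin x _)).ne
  have hB : 0 < m.real (Metric.ball x s) := ENNReal.toReal_pos (hpos hs).ne' (hfin x s).ne
  have hc : 0 < m.real (Metric.closedBall x (R * s)) := ENNReal.toReal_pos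
    ((hpos (mul_pos hR hs)).trans_le (measure_mono Metric.ball_subset_closedBall)).ne' hfinc
  have h4 : m.real (Metric.closedBall x (R * s)) ≤ (C : ℝ) ^ k * m.real (Metric.ball x s) := by
    have h5 := (measure_mono (Metric.closedBall_subset_ball
      (mul_lt_mul_of_pos_right hk hs))).trans (measure_ball_two_pow_mul_le hC x hs k)
    have h6 := ENNReal.toReal_mono (ENNReal.mul_ne_top (by simp) (hfin x s).ne) h5
    simpa [Measure.real] using h6
  have h7 : m.real (Metric.ball x (R * s) \ U) ≤ m.real (Metric.closedBall x (R * s)) -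
      m.real (U ∩ Metric.closedBall x (R * s)) := by
    rw [inter_comm, le_sub_iff_add_le', measureReal_inter_add_sdiff hU hfinc |>.symm]
    gcongr
    · exact measure_ne_top_of_subset sdiff_subset hfinc
    · exact Metric.ball_subset_closedBall
  simp only [Function.comp_apply, ENNReal.toReal_div]
  change _ ≤ (C : ℝ) ^ k * (1 - m.real (U ∩ Metric.closedBall x (R * s)) /
    m.real (Metric.closedBall x (R * s)))
  have h8 : (0 : ℝ) ≤ 1 - m.real (U ∩ Metric.closedBall x (R * s)) /
      m.real (Metric.closedBall x (R * s)) := by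
    rw [sub_nonneg, div_le_one hc]
    exact measureReal_mono inter_subset_right hfinc
  rw [inv_mul_le_iff₀ hB]
  calc _ ≤ _ := h7
    _ = m.real (Metric.closedBall x (R * s)) * (1 - m.real (U ∩ Metric.closedBall x (R * s)) /
      m.real (Metric.closedBall x (R * s))) := by field_simp
    _ ≤ _ := (mul_le_mul_of_nonneg_right h4 h8).trans (le_of_eq (by ring))

end Density

/-! ### Blow-up of a density at a Lebesgue point -/

section BlowUpDensity

variable {E : Type*} [NormedAddCommGroup E] [NormedSpace ℝ E] [MeasurableSpace E] [BorelSpace E]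
  [FiniteDimensional ℝ E]

/-- The rescaled integrals against a density converge at its Lebesgue points. -/
theorem tendsto_integral_mul_density (μ : Measure E) [μ.IsAddHaarMeasure] {ρ : E → ℝ}
    (hρ : LocallyIntegrable ρ μ) {a : E} {M C : ℝ} (hM : 0 < M) (hC : 0 ≤ C)
    (hleb : Tendsto (fun s => ⨍ b in Metric.closedBall a (M * s), ‖ρ b - ρ a‖ ∂μ) (𝓝[>] 0) (𝓝 0))
    {h : ℝ → E → ℝ} (hmeas : ∀ s, Measurable (h s)) (hbound : ∀ s b, |h s b| ≤ C)
    (hsupp : ∀ s > 0, ∀ b, h s b ≠ 0 → b ∈ Metric.closedBall a (M * s)) {k : E → ℝ}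
    (hk : ∀ᵐ u ∂μ, Tendsto (fun s => h s (a + s • u)) (𝓝[>] 0) (𝓝 (k u))) :
    Tendsto (fun s => (s ^ Module.finrank ℝ E)⁻¹ * ∫ b, ρ b * h s b ∂μ) (𝓝[>] 0)
      (𝓝 (ρ a * ∫ u, k u ∂μ)) := by
  have : ProperSpace E := FiniteDimensional.proper ℝ E
  set n := Module.finrank ℝ E
  have hscale : ∀ s > (0 : ℝ), (s ^ n)⁻¹ * ∫ b, h s b ∂μ = ∫ u, h s (a + s • u) ∂μ := by
    intro s hs
    rw [Measure.integral_comp_smul μ (fun u => h s (a + u)) s, integral_add_left_eq_self (h s) a,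
      smul_eq_mul, abs_of_pos (by positivity)]
  have hdom : Tendsto (fun s => ∫ u, h s (a + s • u) ∂μ) (𝓝[>] 0) (𝓝 (∫ u, k u ∂μ)) := by
    refine tendsto_integral_filter_of_dominated_convergence
      ((Metric.closedBall (0 : E) M).indicator fun _ => C) ?_ ?_ ?_ hk
    · exact .of_forall fun s => ((hmeas s).comp (by fun_prop)).aestronglyMeasurable
    · filter_upwards [self_mem_nhdsWithin] with s (hs : 0 < s)
      refine .of_forall fun u => ?_
      by_cases hu : h s (a + s • u) = 0
      · rw [hu, norm_zero]
        exact indicator_nonneg (fun _ _ => hC) _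
      · have h1 := hsupp s hs _ hu
        rw [Metric.mem_closedBall, dist_self_add_left, norm_smul, Real.norm_of_nonneg hs.le,
          mul_comm M] at h1
        rw [indicator_of_mem (mem_closedBall_zero_iff.2 (le_of_mul_le_mul_left h1 hs))]
        exact hbound s _
    · rw [integrable_indicator_iff Metric.isClosed_closedBall.measurableSet]
      exact integrableOn_const (isCompact_closedBall _ _).measure_ne_top
  -- Freezing `ρ` at `a` costs an average of `‖ρ b - ρ a‖`, which vanishes at a Lebesgue point; the
  -- frozen term is `hdom`.
  have hfirst : Tendsto (fun s => (s ^ n)⁻¹ * ∫ b, (ρ b - ρ a) * h s b ∂μ) (𝓝[>] 0) (𝓝 0) := by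
    have h1 := hleb.const_mul (C * (M ^ n * μ.real (Metric.ball 0 1)))
    rw [mul_zero] at h1
    refine squeeze_zero_norm' ?_ h1
    filter_upwards [self_mem_nhdsWithin] with s (hs : 0 < s)
    have hint : IntegrableOn (fun b => ‖ρ b - ρ a‖) (Metric.closedBall a (M * s)) μ :=
      ((hρ.integrableOn_isCompact (isCompact_closedBall _ _)).sub
        (integrableOn_const (isCompact_closedBall _ _).measure_ne_top)).norm
    have h2 : ‖∫ b, (ρ b - ρ a) * h s b ∂μ‖ ≤
        C * ∫ b in Metric.closedBall a (M * s), ‖ρ b - ρ a‖ ∂μ := by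
      rw [← integral_const_mul, ← setIntegral_eq_integral_of_forall_compl_eq_zero
        (s := Metric.closedBall a (M * s))]
      · refine norm_integral_le_of_norm_le (hint.const_mul C) (.of_forall fun b => ?_)
        rw [norm_mul, mul_comm]
        exact mul_le_mul_of_nonneg_right (hbound s b) (norm_nonneg _)
      · intro b hb
        rw [not_not.1 (mt (hsupp s hs b) hb), mul_zero]
    have h3 : μ.real (Metric.closedBall a (M * s)) = (M * s) ^ n * μ.real (Metric.ball 0 1) := by
      rw [Measure.real, Measure.addHaar_closedBall μ a (by positivity), ENNReal.toReal_mul,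
        ENNReal.toReal_ofReal (by positivity)]
      rfl
    have h4 : 0 < μ.real (Metric.ball (0 : E) 1) := ENNReal.toReal_pos
      (Metric.measure_ball_pos μ 0 one_pos).ne' measure_ball_lt_top.ne
    rw [norm_mul, Real.norm_of_nonneg (by positivity)]
    refine (mul_le_mul_of_nonneg_left h2 (by positivity)).trans (le_of_eq ?_)
    rw [setAverage_eq, h3, smul_eq_mul, mul_pow]
    field_simp
  have hsum := hfirst.add (hdom.const_mul (ρ a))
  rw [zero_add] at hsum
  refine hsum.congr' ?_
  filter_upwards [self_mem_nhdsWithin] with s (hs : 0 < s)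
  have hhint : Integrable (h s) μ := by
    have h1 : IntegrableOn (h s) (Metric.closedBall a (M * s)) μ :=
      IntegrableOn.of_bound (isCompact_closedBall _ _).measure_lt_top
        (hmeas s).aestronglyMeasurable C (.of_forall fun b => hbound s b)
    exact (integrableOn_iff_integrable_of_support_subset fun b hb => hsupp s hs b hb).1 h1
  have hρint : Integrable (fun b => ρ b * h s b) μ := by
    have h1 : IntegrableOn (fun b => ρ b * h s b) (Metric.closedBall a (M * s)) μ :=
      (hρ.integrableOn_isCompact (isCompact_closedBall _ _)).mul_bdd (c := C)
        (hmeas s).aestronglyMeasurable (.of_forall fun b => hbound s b)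
    exact (integrableOn_iff_integrable_of_support_subset fun b hb =>
      hsupp s hs b (right_ne_zero_of_mul hb)).1 h1
  rw [← hscale s hs]
  simp only [sub_mul]
  rw [integral_sub hρint (hhint.const_mul _), integral_const_mul]
  ring

end BlowUpDensity

/-! ### The normed model space and its measure -/

section ModelSpace

variable {n : ℕ} (N : NormOn n)

/-- The identity from `ℝⁿ` to its copy with the norm `N`. -/
noncomputable def NormedRn.equiv : EuclideanSpace ℝ (Fin n) ≃L[ℝ] NormedRn N :=
  LinearEquiv.toContinuousLinearEquiv
    { toFun := fun v => v
      invFun := fun v => v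
      left_inv := fun _ => rfl
      right_inv := fun _ => rfl
      map_add' := fun _ _ => rfl
      map_smul' := fun _ _ => rfl }

theorem NormedRn.norm_equiv (v : EuclideanSpace ℝ (Fin n)) :
    ‖NormedRn.equiv N v‖ = N.toSeminorm v := rfl

theorem NormOn.continuous : Continuous N.toSeminorm :=
  continuous_norm.comp (NormedRn.equiv N).continuous

instance NormOn.properSpace_space : ProperSpace N.space.carrier :=
  inferInstanceAs (ProperSpace (NormedRn N))

/-- The identity from `ℝⁿ` to the model space with the norm `N`. -/
noncomputable def NormOn.toSpace (v : EuclideanSpace ℝ (Fin n)) : N.space.carrier :=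
  NormedRn.equiv N v

theorem NormOn.continuous_toSpace : Continuous N.toSpace := (NormedRn.equiv N).continuous

theorem NormOn.toSpace_zero : N.toSpace 0 = N.space.point := (NormedRn.equiv N).map_zero

theorem NormOn.dist_toSpace (v w : EuclideanSpace ℝ (Fin n)) :
    dist (N.toSpace v) (N.toSpace w) = N.toSeminorm (v - w) := by
  change dist (NormedRn.equiv N v) (NormedRn.equiv N w) = _
  rw [dist_eq_norm, ← map_sub, NormedRn.norm_equiv]

/-- Hausdorff measure depends on the metric alone, so it is invariant also under isometries not
known to be linear. -/
theorem NormedRn.map_isometryEquiv (e : NormedRn N ≃ᵢ NormedRn N) :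
    (NormedRn.normalisedHausdorff N).map e = NormedRn.normalisedHausdorff N := by
  rw [NormedRn.normalisedHausdorff, Measure.map_smul, IsometryEquiv.map_hausdorffMeasure]

theorem NormOn.map_isometryEquiv (e : N.space.carrier ≃ᵢ N.space.carrier) :
    N.space.measure.map e = N.space.measure :=
  NormedRn.map_isometryEquiv N e

/-- Makes indicators of rescaled balls converge almost everywhere to the indicator of the limit
ball. -/
theorem NormOn.volume_sphere {R : ℝ} (hR : 0 < R) :
    volume {u : EuclideanSpace ℝ (Fin n) | N.toSeminorm u = R} = 0 := by
  have := (NormedRn.equiv N).isAddHaarMeasure_map volume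
  have h := Measure.addHaar_sphere_of_ne_zero (Measure.map (NormedRn.equiv N) volume) 0 hR.ne'
  rw [Measure.map_apply (NormedRn.equiv N).continuous.measurable
    Metric.isClosed_sphere.measurableSet] at h
  convert h using 2
  ext u
  simp [NormedRn.norm_equiv]

theorem NormOn.isOpen_ball (R : ℝ) :
    IsOpen {u : EuclideanSpace ℝ (Fin n) | N.toSeminorm u < R} :=
  isOpen_lt N.continuous continuous_const

theorem NormOn.preimage_ball (R : ℝ) :
    NormedRn.equiv N ⁻¹' Metric.ball (0 : NormedRn N) R = {u | N.toSeminorm u < R} := by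
  ext u
  simp [NormedRn.norm_equiv]

theorem NormOn.volume_ball_pos :
    0 < (volume : Measure (EuclideanSpace ℝ (Fin n))).real {u | N.toSeminorm u < 1} := by
  have : ProperSpace (NormedRn N) := FiniteDimensional.proper ℝ _
  have := (NormedRn.equiv N).isAddHaarMeasure_map volume
  rw [← NormOn.preimage_ball, Measure.real, ← Measure.map_apply
    (NormedRn.equiv N).continuous.measurable Metric.isOpen_ball.measurableSet]
  exact ENNReal.toReal_pos (Metric.measure_ball_pos _ _ one_pos).ne' measure_ball_lt_top.ne

/-- The normalised Hausdorff measure is the normalised Lebesgue measure. -/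
theorem NormedRn.setIntegral_normalisedHausdorff (R : ℝ) (g : NormedRn N → ℝ) :
    ∫ v in Metric.ball (0 : NormedRn N) R, g v ∂NormedRn.normalisedHausdorff N =
      ((volume : Measure (EuclideanSpace ℝ (Fin n))).real {u | N.toSeminorm u < 1})⁻¹ *
        ∫ u in {u | N.toSeminorm u < R}, g (NormedRn.equiv N u) := by
  have : ProperSpace (NormedRn N) := FiniteDimensional.proper ℝ _
  have h1 := (NormedRn.equiv N).isAddHaarMeasure_map volume
  have h2 := NormedRn.isAddHaarMeasure N
  set ν : Measure (NormedRn N) := Measure.map (NormedRn.equiv N) volume with hν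
  set H : Measure (NormedRn N) := Measure.hausdorffMeasure (n : ℝ) with hH
  have hemb : MeasurableEmbedding (NormedRn.equiv N) :=
    (NormedRn.equiv N).toHomeomorph.measurableEmbedding
  have hball : ν.real (Metric.ball 0 1) =
      (volume : Measure (EuclideanSpace ℝ (Fin n))).real {u | N.toSeminorm u < 1} := by
    rw [Measure.real, hν, hemb.map_apply, NormOn.preimage_ball, Measure.real]
  have hint : ∫ v in Metric.ball (0 : NormedRn N) R, g v ∂ν =
      ∫ u in {u | N.toSeminorm u < R}, g (NormedRn.equiv N u) := by
    rw [hν, hemb.setIntegral_map, NormOn.preimage_ball]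
  -- Haar measures are proportional, and the factor cancels in the normalisation on the unit ball.
  obtain ⟨c, hc0, hc⟩ : ∃ c : ℝ≥0, c ≠ 0 ∧ H = c • ν :=
    ⟨_, (Measure.addHaarScalarFactor_pos_of_isAddHaarMeasure H ν).ne',
      Measure.isAddLeftInvariant_eq_smul H ν⟩
  rw [← hball, ← hint, NormedRn.normalisedHausdorff, ← hH, Measure.restrict_smul,
    integral_smul_measure, hc, Measure.restrict_smul, integral_smul_nnreal_measure,
    ENNReal.toReal_inv, Measure.smul_apply, ENNReal.smul_def, smul_eq_mul (c : ℝ≥0∞), ENNReal.toReal_mul,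
    smul_eq_mul, NNReal.smul_def, smul_eq_mul, ENNReal.coe_toReal, Measure.real]
  have : (c : ℝ) ≠ 0 := by exact_mod_cast hc0
  field_simp

theorem NormOn.setIntegral_space (R : ℝ) (g : N.space.carrier → ℝ) :
    ∫ v in Metric.ball N.space.point R, g v ∂N.space.measure =
      ((volume : Measure (EuclideanSpace ℝ (Fin n))).real {u | N.toSeminorm u < 1})⁻¹ *
        ∫ u in {u | N.toSeminorm u < R}, g (N.toSpace u) :=
  NormedRn.setIntegral_normalisedHausdorff N R g

end ModelSpace

/-! ### Blow-up of a chart at a good point -/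

section Charts

variable {X : Type u} [MetricSpace X] {n : ℕ} {U : Set X} {φ : X → EuclideanSpace ℝ (Fin n)}
  {K L : ℝ≥0} {F : EuclideanSpace ℝ (Fin n) → lp (fun _ : ℕ => ℝ) ∞} {x : X}

/-- The metric differential at a density point of the image of a Lipschitz chart is nondegenerate. -/
theorem norm_le_mul_metricDifferential (hφ : LipschitzWith K φ) (hF : LipschitzWith L F)
    (hdist : ∀ y ∈ U, ∀ z ∈ U, dist y z = ‖F (φ y) - F (φ z)‖) (hx : x ∈ U)
    {S : Seminorm ℝ (EuclideanSpace ℝ (Fin n))}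
    (hS : ∀ u v, Tendsto (fun r : ℝ => ‖F (φ x + r • u) - F (φ x + r • v)‖ / r) (𝓝[>] 0)
      (𝓝 (S (u - v))))
    (hdense : ∀ M : ℝ, ∀ δ > 0, ∀ᶠ r in 𝓝[>] (0 : ℝ), ∀ b, dist b (φ x) ≤ M * r →
      ∃ z ∈ φ '' U, dist b z ≤ δ * r) (v : EuclideanSpace ℝ (Fin n)) :
    ‖v‖ ≤ K * S v := by
  refine le_of_forall_pos_le_add fun η hη => ?_
  -- Some `φ y` with `y ∈ U` lies within `δ * r` of `φ x + r • v`. Then `r * ‖v‖` is about `dist (φ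
  -- y) (φ x) ≤ K * dist y x`, and `dist y x` is about `r * S v`; the errors add up to `δ * (K * (1
  -- + L) + 1) * r`.
  obtain ⟨δ, hδ, hδη⟩ : ∃ δ : ℝ, 0 < δ ∧ δ * (K * (1 + L) + 1) ≤ η :=
    ⟨η / (K * (1 + L) + 1), by positivity, by field_simp; exact le_rfl⟩
  obtain ⟨r, ⟨h1, h2⟩, hr⟩ := (((eventually_abs_norm_sub_le hF hS ‖v‖ hδ).and
    (hdense ‖v‖ δ hδ)).and (self_mem_nhdsWithin (s := Ioi (0 : ℝ)))).exists
  replace hr : 0 < r := hr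
  have h3 := (abs_le.1 (h1 v 0 le_rfl (by simp))).2
  rw [smul_zero, add_zero, sub_zero] at h3
  obtain ⟨_, ⟨y, hy, rfl⟩, hyd⟩ := h2 (φ x + r • v) (by
    rw [dist_self_add_left, norm_smul, Real.norm_of_nonneg hr.le, mul_comm])
  have h4 : dist (φ y) (φ x) ≤ K * dist y x := hφ.dist_le_mul y x
  have h5 := hdist y hy x hx
  have h6 := norm_sub_le_norm_sub_add_norm_sub (F (φ y)) (F (φ x + r • v)) (F (φ x))
  have h7 := hF.dist_le_mul (φ y) (φ x + r • v)
  rw [dist_eq_norm, dist_comm] at h7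
  have h8 := dist_triangle (φ x + r • v) (φ y) (φ x)
  rw [dist_self_add_left, norm_smul, Real.norm_of_nonneg hr.le] at h8
  have h9 : (L : ℝ) * dist (φ x + r • v) (φ y) ≤ L * (δ * r) := mul_le_mul_of_nonneg_left hyd L.2
  have h10 : dist y x ≤ r * S v + δ * r + L * (δ * r) := by linarith
  have h11 : (K : ℝ) * dist y x ≤ K * (r * S v + δ * r + L * (δ * r)) :=
    mul_le_mul_of_nonneg_left h10 K.2
  have h12 : r * ‖v‖ ≤ r * (K * S v + δ * (K * (1 + L) + 1)) := by linarith
  have h13 := le_of_mul_le_mul_left h12 hr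
  linarith

/-- The blow-up with factor `1 / s` at `x` of a chart. -/
noncomputable def blowUpMap (N : NormOn n) (φ : X → EuclideanSpace ℝ (Fin n)) (x : X) (s : ℝ)
    (y : X) : N.space.carrier :=
  N.toSpace (s⁻¹ • (φ y - φ x))

variable [MeasurableSpace X] [BorelSpace X] {m : Measure X}

/-- The measures of the blow-ups of a chart, rescaled by the power of the radius, converge. -/
theorem tendsto_rescaled_integral_blowUpMap
    (hU : MeasurableSet U) (hφ : LipschitzWith K φ) (hF : LipschitzWith L F)
    (hdist : ∀ y ∈ U, ∀ z ∈ U, dist y z = ‖F (φ y) - F (φ z)‖) (hx : x ∈ U) {N : NormOn n}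
    (hN : ∀ u v, Tendsto (fun r : ℝ => ‖F (φ x + r • u) - F (φ x + r • v)‖ / r) (𝓝[>] 0)
      (𝓝 (N.toSeminorm (u - v))))
    (hKN : ∀ v, ‖v‖ ≤ K * N.toSeminorm v)
    {ρ : EuclideanSpace ℝ (Fin n) → ℝ} (hρ : LocallyIntegrable ρ)
    (hρm : ∀ h : EuclideanSpace ℝ (Fin n) → ℝ, Measurable h →
      ∫ y in U, h (φ y) ∂m = ∫ b, ρ b * h b)
    (hleb : ∀ M > 0, Tendsto (fun s => ⨍ b in Metric.closedBall (φ x) (M * s), ‖ρ b - ρ (φ x)‖)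
      (𝓝[>] 0) (𝓝 0))
    {R : ℝ} (hR : 0 < R) (g : BoundedContinuousFunction N.space.carrier ℝ) :
    Tendsto (fun s => (s ^ Module.finrank ℝ (EuclideanSpace ℝ (Fin n)))⁻¹ *
      ∫ y in Metric.ball x (R * s) ∩ U, g (blowUpMap N φ x s y) ∂m) (𝓝[>] 0)
      (𝓝 (ρ (φ x) * ∫ u in {u | N.toSeminorm u < R}, g (N.toSpace u))) := by
  set a := φ x with ha
  -- This transfers the ball of `X` to `ℝⁿ` through `F`. Off `φ '' U` the map `F` may be degenerate,
  -- so the closed ball is needed to bound the support; `K + 1` keeps its radius positive when `K =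
  -- 0`.
  let T : ℝ → Set (EuclideanSpace ℝ (Fin n)) := fun s =>
    {b | ‖F b - F a‖ < R * s} ∩ Metric.closedBall a ((K + 1) * R * s)
  have hTm : ∀ s, MeasurableSet (T s) := fun s =>
    (isOpen_lt (hF.continuous.sub continuous_const).norm continuous_const).measurableSet.inter
      Metric.isClosed_closedBall.measurableSet
  have hM : (0 : ℝ) < (K + 1) * R := by positivity
  have hgm : ∀ s : ℝ, Measurable ((T s).indicator fun b => g (N.toSpace (s⁻¹ • (b - a)))) := by
    intro s
    have h1 : Continuous fun b : EuclideanSpace ℝ (Fin n) => s⁻¹ • (b - a) := by fun_prop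
    exact (g.continuous.comp (N.continuous_toSpace.comp h1)).measurable.indicator (hTm s)
  have hmain := tendsto_integral_mul_density volume hρ (a := a) hM (norm_nonneg g) (hleb _ hM)
    (h := fun s => (T s).indicator fun b => g (N.toSpace (s⁻¹ • (b - a))))
    (k := {u | N.toSeminorm u < R}.indicator fun u => g (N.toSpace u))
    hgm
    (fun s b => (norm_indicator_le_norm_self (fun b => g (N.toSpace (s⁻¹ • (b - a)))) b).trans
      (g.norm_coe_le_norm _))
    (fun s _ b hb => (mem_of_indicator_ne_zero hb).2) ?_
  · rw [integral_indicator (N.isOpen_ball R).measurableSet] at hmain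
    refine hmain.congr' ?_
    filter_upwards [self_mem_nhdsWithin] with s (hs : 0 < s)
    rw [← hρm _ (hgm s), inter_comm, ← setIntegral_indicator
      Metric.isOpen_ball.measurableSet]
    congr 1
    refine setIntegral_congr_fun hU fun y hy => ?_
    have hiff : φ y ∈ T s ↔ y ∈ Metric.ball x (R * s) := by
      rw [Metric.mem_ball, hdist y hy x hx]
      refine ⟨fun h => h.1, fun h => ⟨h, ?_⟩⟩
      rw [← hdist y hy x hx] at h
      rw [Metric.mem_closedBall]
      refine (hφ.dist_le_mul y x).trans ?_
      have h1 : (K : ℝ) * dist y x ≤ K * (R * s) := mul_le_mul_of_nonneg_left h.le K.2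
      nlinarith [mul_pos hR hs]
    by_cases h : y ∈ Metric.ball x (R * s)
    · simp only [indicator_of_mem h, indicator_of_mem (hiff.2 h)]
      rfl
    · simp only [indicator_of_notMem h, indicator_of_notMem (mt hiff.1 h)]
  · have hne : ∀ᵐ u : EuclideanSpace ℝ (Fin n), N.toSeminorm u ≠ R :=
      measure_eq_zero_iff_ae_notMem.1 (N.volume_sphere hR)
    filter_upwards [hne] with u hu
    have h0 := hN u 0
    simp only [smul_zero, add_zero, sub_zero] at h0
    rcases lt_or_gt_of_ne hu with hlt | hgt
    · rw [indicator_of_mem (show u ∈ {u | N.toSeminorm u < R} from hlt)]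
      refine tendsto_const_nhds.congr' ?_
      filter_upwards [h0.eventually_lt_const hlt, self_mem_nhdsWithin] with s h1 (hs : 0 < s)
      rw [indicator_of_mem, add_sub_cancel_left, inv_smul_smul₀ hs.ne']
      refine ⟨(div_lt_iff₀ hs).1 h1, ?_⟩
      rw [Metric.mem_closedBall, dist_self_add_left, norm_smul, Real.norm_of_nonneg hs.le,
        mul_comm]
      refine mul_le_mul_of_nonneg_right ((hKN u).trans ?_) hs.le
      have h2 : (K : ℝ) * N.toSeminorm u ≤ K * R := mul_le_mul_of_nonneg_left hlt.le K.2
      linarith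
    · rw [indicator_of_notMem (show u ∉ {u | N.toSeminorm u < R} from not_lt.2 hgt.le)]
      refine tendsto_const_nhds.congr' ?_
      filter_upwards [h0.eventually_const_lt hgt, self_mem_nhdsWithin] with s h1 (hs : 0 < s)
      rw [indicator_of_notMem]
      exact fun h2 => not_lt.2 h2.1.le ((lt_div_iff₀ hs).1 h1)

/-- At a point of metric differentiability and of density, the blow-ups of a chart converge to
`ℝⁿ` with the metric differential and its normalised Hausdorff measure. -/
theorem isBlowUpModel_blowUpMap (hfin : BoundedlyFinite m)
    (hU : MeasurableSet U) (hφ : LipschitzWith K φ) (hF : LipschitzWith L F)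
    (hdist : ∀ y ∈ U, ∀ z ∈ U, dist y z = ‖F (φ y) - F (φ z)‖) (hx : x ∈ U) {N : NormOn n}
    (hN : ∀ u v, Tendsto (fun r : ℝ => ‖F (φ x + r • u) - F (φ x + r • v)‖ / r) (𝓝[>] 0)
      (𝓝 (N.toSeminorm (u - v))))
    (hφdense : ∀ M : ℝ, ∀ δ > 0, ∀ᶠ r in 𝓝[>] (0 : ℝ), ∀ b, dist b (φ x) ≤ M * r →
      ∃ z ∈ φ '' U, dist b z ≤ δ * r)
    (hdense : ∀ M : ℝ, ∀ δ > 0, ∀ᶠ r in 𝓝[>] (0 : ℝ), ∀ y, dist y x ≤ M * r →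
      ∃ z ∈ U, dist y z ≤ δ * r)
    (hcompl : ∀ R > 0, Tendsto (fun s => (m.real (Metric.ball x s))⁻¹ *
      m.real (Metric.ball x (R * s) \ U)) (𝓝[>] 0) (𝓝 0))
    (hpos : ∀ s > 0, 0 < m (Metric.ball x s))
    {ρ : EuclideanSpace ℝ (Fin n) → ℝ} (hρ : LocallyIntegrable ρ)
    (hρm : ∀ h : EuclideanSpace ℝ (Fin n) → ℝ, Measurable h →
      ∫ y in U, h (φ y) ∂m = ∫ b, ρ b * h b)
    (hρpos : 0 < ρ (φ x))
    (hleb : ∀ M > 0, Tendsto (fun s => ⨍ b in Metric.closedBall (φ x) (M * s), ‖ρ b - ρ (φ x)‖)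
      (𝓝[>] 0) (𝓝 0)) :
    IsBlowUpModel m x U N.space (blowUpMap N φ x) := by
  have hKN := norm_le_mul_metricDifferential hφ hF hdist hx hN hφdense
  have hNL : ∀ v, N.toSeminorm v ≤ L * ‖v‖ := by
    intro v
    refine le_of_tendsto (by simpa using hN v 0) ?_
    filter_upwards [self_mem_nhdsWithin] with r (hr : 0 < r)
    rw [div_le_iff₀ hr, ← dist_eq_norm]
    refine (hF.dist_le_mul _ _).trans (le_of_eq ?_)
    rw [dist_self_add_left, norm_smul, Real.norm_of_nonneg hr.le]
    ring
  set a := φ x with ha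
  have hback : ∀ s > (0 : ℝ), ∀ y, a + s • s⁻¹ • (φ y - a) = φ y := fun s hs y => by
    rw [smul_inv_smul₀ hs.ne', add_sub_cancel]
  refine ⟨hU, hx, fun s => ?_, fun s => ?_, fun M δ hδ => ?_, fun M δ hδ => ?_, fun M δ hδ => ?_,
    fun R hR g => ?_, hcompl⟩
  · have h1 : Continuous fun y => s⁻¹ • (φ y - φ x) := by
      have h2 := hφ.continuous
      fun_prop
    exact (N.continuous_toSpace.comp h1).measurable
  · rw [blowUpMap, sub_self, smul_zero, N.toSpace_zero]
  · filter_upwards [eventually_abs_norm_sub_le hF hN (K * M) hδ, self_mem_nhdsWithin] with s h1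
      (hs : 0 < s) y hy z hz
    have hle : ∀ w ∈ U ∩ Metric.ball x (M * s), ‖s⁻¹ • (φ w - a)‖ ≤ K * M := by
      intro w hw
      rw [norm_smul, norm_inv, Real.norm_of_nonneg hs.le, inv_mul_le_iff₀ hs, ← dist_eq_norm]
      refine (hφ.dist_le_mul w x).trans ?_
      have : (K : ℝ) * dist w x ≤ K * (M * s) :=
        mul_le_mul_of_nonneg_left (Metric.mem_ball.1 hw.2).le K.2
      linarith
    have h2 := h1 _ _ (hle y hy) (hle z hz)
    rwa [hback s hs, hback s hs, ← hdist y hy.1 z hz.1, ← N.dist_toSpace] at h2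
  -- One `δ'` pays for the differentiability error, and `L * δ'` for moving `a + s • v` to a point
  -- of `φ '' U`.
  · obtain ⟨δ', hδ', hδδ⟩ : ∃ δ' : ℝ, 0 < δ' ∧ δ' * (1 + L) < δ :=
      ⟨δ / (1 + L) / 2, by positivity, by field_simp; linarith⟩
    filter_upwards [eventually_abs_norm_sub_le hF hN (K * M) hδ', hφdense (K * M) δ' hδ',
      self_mem_nhdsWithin] with s h1 h2 (hs : 0 < s) v hv
    obtain ⟨v, rfl⟩ : ∃ u, N.toSpace u = v := ⟨v, rfl⟩
    rw [← N.toSpace_zero, N.dist_toSpace, sub_zero] at hv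
    have hvK : ‖v‖ ≤ K * M := (hKN v).trans (mul_le_mul_of_nonneg_left hv.le K.2)
    have hKM : 0 ≤ K * M := (norm_nonneg v).trans hvK
    have h3 := (abs_le.1 (h1 v 0 hvK (by simpa using hKM))).2
    rw [smul_zero, add_zero, sub_zero] at h3
    obtain ⟨_, ⟨y, hy, rfl⟩, hyd⟩ := h2 (a + s • v) (by
      rw [dist_self_add_left, norm_smul, Real.norm_of_nonneg hs.le, mul_comm]
      exact mul_le_mul_of_nonneg_right hvK hs.le)
    have h9 : (L : ℝ) * dist (a + s • v) (φ y) ≤ L * (δ' * s) :=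
      mul_le_mul_of_nonneg_left hyd L.2
    refine ⟨y, ⟨hy, ?_⟩, ?_⟩
    · have h6 := norm_sub_le_norm_sub_add_norm_sub (F (φ y)) (F (a + s • v)) (F a)
      have h7 := hF.dist_le_mul (φ y) (a + s • v)
      rw [dist_eq_norm, dist_comm] at h7
      rw [Metric.mem_ball, hdist y hy x hx]
      nlinarith
    · rw [blowUpMap, N.dist_toSpace]
      refine (hNL _).trans ?_
      have h4 : s⁻¹ • (φ y - a) - v = s⁻¹ • (φ y - (a + s • v)) := by
        rw [← sub_sub, smul_sub s⁻¹ (φ y - a), inv_smul_smul₀ hs.ne']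
      rw [h4, norm_smul, norm_inv, Real.norm_of_nonneg hs.le, mul_left_comm,
        inv_mul_le_iff₀ hs, ← dist_eq_norm, dist_comm]
      nlinarith
  · filter_upwards [hdense M (δ / 2) (by positivity), self_mem_nhdsWithin] with s h1 (hs : 0 < s)
      y hy
    obtain ⟨z, hz, hyz⟩ := h1 y (Metric.mem_ball.1 hy).le
    exact ⟨z, hz, hyz.trans_lt (by nlinarith)⟩
  · set d := Module.finrank ℝ (EuclideanSpace ℝ (Fin n))
    have hgen := fun {R : ℝ} (hR : 0 < R) (g : BoundedContinuousFunction N.space.carrier ℝ) =>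
      tendsto_rescaled_integral_blowUpMap hU hφ hF hdist hx hN hKN hρ hρm hleb hR g
    have h1 := hgen one_pos (BoundedContinuousFunction.const _ 1)
    simp only [BoundedContinuousFunction.const_apply, setIntegral_const, smul_eq_mul, mul_one,
      one_mul] at h1
    have hκ : 0 < ρ a * (volume : Measure (EuclideanSpace ℝ (Fin n))).real
        {u | N.toSeminorm u < 1} := mul_pos hρpos N.volume_ball_pos
    have h2 : Tendsto (fun s => (m.real (Metric.ball x s))⁻¹ * m.real (Metric.ball x s ∩ U))
        (𝓝[>] 0) (𝓝 1) := by
      have h3 := (hcompl 1 one_pos).const_sub 1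
      rw [sub_zero] at h3
      refine h3.congr' ?_
      filter_upwards [self_mem_nhdsWithin] with s (hs : 0 < s)
      have h4 : 0 < m.real (Metric.ball x s) := ENNReal.toReal_pos (hpos s hs).ne' (hfin x s).ne
      have h5 := measureReal_inter_add_sdiff (μ := m) (s := Metric.ball x s) hU (hfin x s).ne
      rw [one_mul]
      field_simp
      linarith
    -- The normalised integral is split through `m (B_s ∩ U)` and the power of `s`, so that the
    -- factor `ρ a` cancels in the limit.
    have h6 := (h2.mul (h1.inv₀ hκ.ne')).mul (hgen hR g)
    have h7 : 1 * (ρ a * (volume : Measure (EuclideanSpace ℝ (Fin n))).real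
        {u | N.toSeminorm u < 1})⁻¹ *
        (ρ a * ∫ u in {u | N.toSeminorm u < R}, g (N.toSpace u)) =
        ∫ v in Metric.ball N.space.point R, g v ∂N.space.measure := by
      rw [N.setIntegral_space]
      field_simp
    rw [h7] at h6
    refine h6.congr' ?_
    filter_upwards [h1.eventually_const_lt hκ, self_mem_nhdsWithin] with s h8 (hs : 0 < s)
    have h9 : m.real (Metric.ball x s ∩ U) ≠ 0 := right_ne_zero_of_mul h8.ne'
    have h10 : s ^ d ≠ 0 := by positivity
    field_simp

end Charts

/-! ### Almost every point of a chart domain is good -/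

section AlmostEverywhere

variable {X : Type u} [MetricSpace X] [MeasurableSpace X] [BorelSpace X] {m : Measure X} {n : ℕ}
  {U : Set X} {φ : X → EuclideanSpace ℝ (Fin n)}

theorem IsChart.injOn (h : IsChart m U φ) : InjOn φ U := by
  obtain ⟨K, hK⟩ := h.antilipschitz
  exact injOn_iff_injective.2 hK.injective

/-- The metric of a chart domain is read off from an extension of the inverse of the chart. -/
theorem IsChart.dist_eq_of_isLinftyExtension (h : IsChart m U φ)
    {F : EuclideanSpace ℝ (Fin n) → lp (fun _ : ℕ => ℝ) ∞}
    (hF : IsLinftyExtension (inverseOn U φ) F) {y z : X} (hy : y ∈ U) (hz : z ∈ U) :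
    dist y z = ‖F (φ y) - F (φ z)‖ := by
  obtain ⟨ι, hι, -, hext⟩ := hF
  have hFι : ∀ w ∈ U, F (φ w) = ι w := fun w hw => by
    have := hext ⟨φ w, mem_image_of_mem φ hw⟩
    rwa [inverseOn_apply h.injOn hw] at this
  have hr : ∀ w ∈ U, w ∈ range (inverseOn U φ) := fun w hw => ⟨_, inverseOn_apply h.injOn hw⟩
  rw [hFι y hy, hFι z hz, ← dist_eq_norm, hι y (hr y hy) z (hr z hz)]

theorem hausdorffMeasure_absolutelyContinuous_volume :
    (Measure.hausdorffMeasure (n : ℝ) : Measure (EuclideanSpace ℝ (Fin n))) ≪ volume := by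
  have h := isAddHaarMeasure_hausdorffMeasure (E := EuclideanSpace ℝ (Fin n))
  rw [finrank_euclideanSpace_fin] at h
  rw [Measure.isAddLeftInvariant_eq_smul (Measure.hausdorffMeasure (n : ℝ)) volume]
  exact Measure.smul_absolutelyContinuous

/-- The image under a chart of the measure is absolutely continuous. -/
theorem IsChart.map_absolutelyContinuous (h : IsChart m U φ) {φ' : X → EuclideanSpace ℝ (Fin n)}
    (hφ' : Measurable φ') (heq : EqOn φ φ' U) : (m.restrict U).map φ' ≪ volume := by
  refine Measure.AbsolutelyContinuous.mk fun A hA hA0 => ?_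
  obtain ⟨K, hK⟩ := h.antilipschitz
  have hinter : m.restrict U (φ' ⁻¹' A) = m.restrict U (φ' ⁻¹' A ∩ U) := by
    rw [Measure.restrict_apply' h.measurableSet, Measure.restrict_apply' h.measurableSet,
      inter_assoc, inter_self]
  rw [Measure.map_apply hφ' hA, hinter]
  refine h.absolutelyContinuous ?_
  -- The inverse chart is Lipschitz, so it takes Lebesgue-null sets to `ℋⁿ`-null sets, which `m`
  -- does not charge on `U`.
  have h1 := hK.hausdorffMeasure_preimage_le (d := n) n.cast_nonneg A
  rw [hausdorffMeasure_absolutelyContinuous_volume hA0, mul_zero, nonpos_iff_eq_zero] at h1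
  rw [← (isometry_subtype_coe (s := U)).hausdorffMeasure_image (.inl n.cast_nonneg)] at h1
  refine measure_mono_null ?_ h1
  rintro y ⟨hyA, hyU⟩
  refine ⟨⟨y, hyU⟩, ?_, rfl⟩
  change φ y ∈ A
  rw [heq hyU]
  exact hyA

/-- The image under a chart of the measure is locally finite. -/
theorem IsChart.map_isLocallyFinite (h : IsChart m U φ) (hfin : BoundedlyFinite m)
    {φ' : X → EuclideanSpace ℝ (Fin n)} (hφ' : Measurable φ') (heq : EqOn φ φ' U) :
    IsLocallyFiniteMeasure ((m.restrict U).map φ') := by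
  obtain ⟨K, hK⟩ := h.antilipschitz
  refine ⟨fun a => ⟨Metric.ball a 1, Metric.ball_mem_nhds a one_pos, ?_⟩⟩
  rw [Measure.map_apply hφ' Metric.isOpen_ball.measurableSet,
    Measure.restrict_apply' h.measurableSet]
  rcases (φ' ⁻¹' Metric.ball a 1 ∩ U).eq_empty_or_nonempty with he | ⟨y, hy, hyU⟩
  · simp [he]
  · refine (measure_mono ?_).trans_lt (hfin y (K * 2 + 1))
    rintro z ⟨hz, hzU⟩
    have h1 : dist z y ≤ K * dist (φ z) (φ y) := hK.le_mul_dist ⟨z, hzU⟩ ⟨y, hyU⟩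
    rw [heq hzU, heq hyU] at h1
    have h2 : dist (φ' z) (φ' y) ≤ 2 := by
      have h3 : dist (φ' z) a < 1 := hz
      have h4 : dist (φ' y) a < 1 := hy
      linarith [dist_triangle_right (φ' z) (φ' y) a]
    have h5 : (K : ℝ) * dist (φ' z) (φ' y) ≤ K * 2 := mul_le_mul_of_nonneg_left h2 K.2
    rw [Metric.mem_ball]
    linarith

theorem locallyIntegrable_toReal_rnDeriv {E : Type*} [TopologicalSpace E] [LocallyCompactSpace E]
    [R1Space E] [MeasurableSpace E] [OpensMeasurableSpace E] (μ ν : Measure E)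
    [IsFiniteMeasureOnCompacts μ] [SFinite ν] :
    LocallyIntegrable (fun x => (μ.rnDeriv ν x).toReal) ν := by
  intro x
  obtain ⟨k, hk, hxk⟩ := exists_compact_mem_nhds x
  exact ⟨k, hxk, integrable_toReal_of_lintegral_ne_top
    (Measure.measurable_rnDeriv μ ν).aemeasurable
    ((Measure.setLIntegral_rnDeriv_le k).trans_lt hk.measure_lt_top).ne⟩

/-- At almost every point of a chart domain of a doubling space the metric differential exists, is
a norm, and gives a model of the blow-ups. -/
theorem IsChart.ae_exists_isBlowUpModel [TopologicalSpace.SeparableSpace X] (h : IsChart m U φ)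
    (hfin : BoundedlyFinite m) (hm : IsDoubling m)
    {F : EuclideanSpace ℝ (Fin n) → lp (fun _ : ℕ => ℝ) ∞}
    (hF : IsLinftyExtension (inverseOn U φ) F) :
    ∀ᵐ x ∂m.restrict U, ∃ N : NormOn n, HasMetricDifferential F (φ x) N ∧
      ∃ β, IsBlowUpModel m x U N.space β := by
  rcases eq_or_ne m 0 with rfl | hne
  · simp
  have : SecondCountableTopology X := UniformSpace.secondCountable_of_separable X
  have := hfin.isLocallyFiniteMeasure
  have := hm.isUnifLocDoublingMeasure
  have hdist := fun y hy z hz => h.dist_eq_of_isLinftyExtension hF (y := y) (z := z) hy hz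
  obtain ⟨-, -, ⟨L, hL⟩, -⟩ := hF
  obtain ⟨K₀, hK₀⟩ := h.lipschitz
  -- The chart is controlled only on `U`; a global Lipschitz extension makes image measures and
  -- blow-up maps measurable.
  obtain ⟨φ', hφ', heq⟩ := hK₀.extend_finite_dimension
  have hφm : Measurable φ' := hφ'.continuous.measurable
  set μ := (m.restrict U).map φ' with hμ
  have hac : μ ≪ volume := h.map_absolutelyContinuous hφm heq
  have : IsLocallyFiniteMeasure μ := h.map_isLocallyFinite hfin hφm heq
  set ρ : EuclideanSpace ℝ (Fin n) → ℝ := fun b => (μ.rnDeriv volume b).toReal with hρdef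
  have hρ : LocallyIntegrable ρ := locallyIntegrable_toReal_rnDeriv μ volume
  have hdist' : ∀ y ∈ U, ∀ z ∈ U, dist y z = ‖F (φ' y) - F (φ' z)‖ := fun y hy z hz => by
    rw [← heq hy, ← heq hz]
    exact hdist y hy z hz
  have hpull : ∀ {q : EuclideanSpace ℝ (Fin n) → Prop}, (∀ᵐ a ∂μ, q a) →
      ∀ᵐ x ∂m.restrict U, q (φ' x) := fun hq => ae_of_ae_map hφm.aemeasurable hq
  have hleb : ∀ᵐ a, ∀ M > 0, Tendsto (fun s => ⨍ b in Metric.closedBall a (M * s), ‖ρ b - ρ a‖)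
      (𝓝[>] 0) (𝓝 0) := by
    filter_upwards [IsUnifLocDoublingMeasure.ae_tendsto_average_norm_sub.{_, _, 0} volume hρ 1]
      with a ha M hM
    refine ha (fun _ => a) (fun s => M * s) (tendsto_nhdsWithin_iff.2 ⟨?_, ?_⟩) ?_
    · have : Tendsto (fun r : ℝ => M * r) (𝓝 0) (𝓝 (M * 0)) := tendsto_id.const_mul M
      rw [mul_zero] at this
      exact this.mono_left nhdsWithin_le_nhds
    · filter_upwards [self_mem_nhdsWithin] with r (hr : 0 < r)
      exact mul_pos hM hr
    · filter_upwards [self_mem_nhdsWithin] with r (hr : 0 < r)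
      exact Metric.mem_closedBall_self (by positivity)
  -- Positivity holds almost everywhere for the image measure `μ`, and that is what pulls back to
  -- `m` on `U`.
  have hρpos : ∀ᵐ a ∂μ, 0 < ρ a := by
    filter_upwards [Measure.rnDeriv_pos hac, hac (Measure.rnDeriv_lt_top μ volume)] with a h1 h2
    exact ENNReal.toReal_pos h1.ne' h2.ne
  have hρm : ∀ g : EuclideanSpace ℝ (Fin n) → ℝ, Measurable g →
      ∫ y in U, g (φ' y) ∂m = ∫ b, ρ b * g b := by
    intro g hg
    have h1 := integral_rnDeriv_smul (f := g) hac
    rw [hμ, integral_map hφm.aemeasurable hg.aestronglyMeasurable] at h1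
    exact h1.symm
  -- Lebesgue-almost-everywhere properties in `ℝⁿ` pass to `μ` by absolute continuity and then to
  -- `U`. The set `φ' '' U` is not shown to be measurable; the density statement holds for arbitrary
  -- sets.
  filter_upwards [hpull (hac (ae_tendsto_coordSeminorm volume hL)),
    hpull (hac (ae_imp_of_ae_restrict (ae_exists_dist_le_of_doubling volume (φ' '' U)))),
    hpull (hac hleb), hpull hρpos, ae_exists_dist_le_of_doubling m U,
    hm.ae_tendsto_measureReal_diff hfin h.measurableSet, ae_restrict_mem h.measurableSet]
    with x hx1 hx2 hx3 hx4 hx5 hx6 hxU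
  replace hx2 := hx2 (mem_image_of_mem φ' hxU)
  have hnorm := norm_le_mul_metricDifferential hφ' hL hdist' hxU hx1 hx2
  let N : NormOn n :=
    { coordSeminorm hL (φ' x) with
      eq_zero_of_map_eq_zero := fun v hv => by
        have h1 := hnorm v
        rw [show coordSeminorm hL (φ' x) v = 0 from hv, mul_zero] at h1
        exact norm_le_zero_iff.1 h1 }
  refine ⟨N, fun v => ?_, blowUpMap N φ' x, ?_⟩
  · have h1 := hx1 v 0
    simp only [smul_zero, add_zero, sub_zero] at h1
    rw [heq hxU]
    exact h1
  · exact isBlowUpModel_blowUpMap hfin h.measurableSet hφ' hL hdist' hxU hx1 hx2 hx5 hx6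
      (fun s hs => hm.measure_ball_pos hne x hs) hρ hρm hx4 hx3

end AlmostEverywhere

end MetricMeasure

theorem proposition3p2 {X : Type u} [MetricSpace X] [CompleteSpace X]
    [TopologicalSpace.SeparableSpace X] [MeasurableSpace X] [BorelSpace X] (m : Measure X)
    (hfin : MetricMeasure.BoundedlyFinite m) (hdoubling : MetricMeasure.IsDoubling m)
    (hrect : MetricMeasure.IsRectifiable m) :
    ∀ (A : MetricMeasure.Atlas m)
      (F : (i : ℕ) → EuclideanSpace ℝ (Fin (A.dim i)) → lp (fun _ : ℕ => ℝ) ∞),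
      (∀ i, MetricMeasure.IsLinftyExtension (MetricMeasure.inverseOn (A.U i) (A.φ i)) (F i)) →
      ∀ᵐ x ∂m, ∀ i, x ∈ A.U i →
        ∃ N : MetricMeasure.NormOn (A.dim i),
          MetricMeasure.HasMetricDifferential (F i) (A.φ i x) N ∧
          N.space ∈ MetricMeasure.TangentCone m x ∧
          ∀ Y ∈ MetricMeasure.TangentCone.{u, v} m x, Y.Iso N.space := by
  intro A F hF
  refine ae_all_iff.2 fun i => ae_imp_of_ae_restrict ?_
  filter_upwards [(A.isChart i).ae_exists_isBlowUpModel hfin hdoubling (hF i)] with x hx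
  obtain ⟨N, hN, β, hβ⟩ := hx
  exact ⟨N, hN, hβ.mem_tangentCone hfin, fun Y hY => hβ.iso hfin N.map_isometryEquiv hY⟩
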